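/- Let $k$ be a field and let $A$ be a Hopf $k$-algebra, with coproduct $\Delta(a)=\sum a_1\otimes a_2$, counit $\epsilon$ and antipode $S$. Suppose that $A$ is (left and right) noetherian, that $S$ is bijective, and that $A$ is AS-Gorenstein of dimension $d$: $\operatorname{injdim}({}_AA)=d<\infty$, $\dim_k\operatorname{Ext}^d_A({}_Ak,{}_AA)=1$, $\operatorname{Ext}^i_A({}_Ak,{}_AA)=0$ for $i\ne d$, and the same holds for right modules. Let $\pi_0:A\to k$ be the algebra map by which $A$ acts from the right on the one-dimensional space $\operatorname{Ext}^d_A({}_Ak,{}_AA)$, and let $$\xi(a)=\sum\pi_0(a_1)a_2,\qquad \phi(a)=\sum a_1\pi_0(a_2)$$ be the associated left and right winding automorphisms of $A$. The integral order $io(A)\in\{1,2,\dots\}\cup\{\infty\}$ is the order of $\xi$. With $A^e=A\otimes_k A^{\mathrm{op}}$, a Nakayama automorphism of $A$ is an algebra automorphism $\nu$ such that $\operatorname{Ext}^i_{A^e}(A,A^e)=0$ for $i\neq d$ and $\operatorname{Ext}^d_{A^e}(A,A^e)\cong{}^1A^\nu$ as $A$-bimodules, where ${}^1A^\nu$ is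 $A$ with the action $b\cdot a\cdot c=b\,a\,\nu(c)$. The Nakayama order $o(A)\in\{1,2,\dots\}\cup\{\infty\}$ is the smallest positive $n$ such that $\nu^n$ is inner (conjugation by a unit), or $\infty$ if there is none. Then: (a) $S^4=\gamma\circ\phi\circ\xi^{-1}$ for an inner automorphism $\gamma$ of $A$, and $\gamma$, $\phi$, $\xi$ commute with each other. (b) $A$ has a Nakayama automorphism, and its Nakayama order $o(A)$, which does not depend on the choice of $\nu$, is equal to $io(A)$ or to $2\,io(A)$ (with $2\cdot\infty=\infty$). (c) If $io(A)$ is finite, then $S^{4\,io(A)}$ is an inner automorphism. (d) If $A$ has, up to isomorphism, only finitely many one-dimensional modules, then $io(A)$ is finite, some positive power of $S$ is inner, and for every Nakayama automorphism $\nu$ of $A$ some positive power of $\nu$ is inner. -/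

import Mathlib

open CategoryTheory CategoryTheory.Abelian TensorProduct MulOpposite

universe v u

namespace HopfNakayama

noncomputable section

section Ext

variable {R : Type u} [Ring R]

/-- The right action of `r : R` on `Ext^n_R(M, R)`: functoriality of `Ext` in the second argument,
applied to the endomorphism `x ↦ x * r` of the left module `R`. -/
def extRightMul {M : ModuleCat.{u} R} {n : ℕ} (e : Ext M (ModuleCat.of R R) n) (r : R) :
    Ext M (ModuleCat.of R R) n :=
  e.comp (Ext.mk₀ (ModuleCat.ofHom (LinearMap.toSpanSingleton R R r))) (add_zero n)

lemma extRightMul_mul {M : ModuleCat.{u} R} {n : ℕ} (e : Ext M (ModuleCat.of R R) n) (r s : R) :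
    extRightMul e (r * s) = extRightMul (extRightMul e r) s := by
  have h : LinearMap.toSpanSingleton R R (r * s) =
      (LinearMap.toSpanSingleton R R s).comp (LinearMap.toSpanSingleton R R r) := by
    ext; simp
  simp only [extRightMul]
  rw [h, ModuleCat.ofHom_comp, ← Ext.mk₀_comp_mk₀, Ext.comp_assoc_of_second_deg_zero]

lemma extRightMul_add {M : ModuleCat.{u} R} {n : ℕ} (e : Ext M (ModuleCat.of R R) n) (r s : R) :
    extRightMul e (r + s) = extRightMul e r + extRightMul e s := by
  have h : ModuleCat.ofHom (LinearMap.toSpanSingleton R R (r + s)) =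
      ModuleCat.ofHom (LinearMap.toSpanSingleton R R r) +
        ModuleCat.ofHom (LinearMap.toSpanSingleton R R s) := by
    ext; simp
  simp only [extRightMul]
  rw [h, Ext.mk₀_add, Ext.comp_add]

lemma extRightMul_one {M : ModuleCat.{u} R} {n : ℕ} (e : Ext M (ModuleCat.of R R) n) :
    extRightMul e (1 : R) = e := by
  have h : ModuleCat.ofHom (LinearMap.toSpanSingleton R R (1 : R)) =
      𝟙 (ModuleCat.of R R) := by
    ext; simp
  simp only [extRightMul]
  rw [h, Ext.comp_mk₀_id]

end Ext

section Gorenstein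

variable {k : Type v} [Field k] {B : Type u} [Ring B] [Algebra k B]

lemma extRightMul_algebraMap {M : ModuleCat.{u} B} {n : ℕ} (e : Ext M (ModuleCat.of B B) n)
    (c : k) : extRightMul e (algebraMap k B c) = c • e := by
  rw [Ext.smul_eq_comp_mk₀]
  simp only [extRightMul]
  congr 2
  ext
  change (1 : B) * algebraMap k B c = algebraMap k B c * 1
  simp

/-- The trivial left module `B / ker ε` of an augmented algebra `(B, ε)`. -/
def trivialModule (ε : B →ₐ[k] k) : ModuleCat.{u} B :=
  ModuleCat.of B (B ⧸ (RingHom.ker ε : Submodule B B))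

/-- The augmentation of the opposite algebra. Left `Bᵐᵒᵖ`-modules are right `B`-modules. -/
def oppositeAugmentation (ε : B →ₐ[k] k) : Bᵐᵒᵖ →ₐ[k] k :=
  ε.fromOpposite fun _ _ => Commute.all _ _

/-- The one-sided Artin-Schelter Gorenstein conditions for left modules:
`injdim B = d`, `dim_k Ext^d_B(k, B) = 1` and `Ext^i_B(k, B) = 0` for `i ≠ d`. -/
structure IsLeftASGorenstein (ε : B →ₐ[k] k) (d : ℕ) : Prop where
  injectiveDimension_eq : injectiveDimension (ModuleCat.of B B) = d
  finrank_ext : Module.finrank k (Ext (trivialModule ε) (ModuleCat.of B B) d) = 1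
  ext_eq_zero : ∀ i : ℕ, i ≠ d → Subsingleton (Ext (trivialModule ε) (ModuleCat.of B B) i)

/-- The Artin-Schelter Gorenstein condition, on both sides, of injective dimension `d`. -/
structure IsASGorenstein (ε : B →ₐ[k] k) (d : ℕ) : Prop where
  left : IsLeftASGorenstein ε d
  right : IsLeftASGorenstein (oppositeAugmentation ε) d

lemma IsLeftASGorenstein.exists_scalar {ε : B →ₐ[k] k} {d : ℕ} (h : IsLeftASGorenstein ε d)
    (b : B) : ∃ c : k, ∀ e : Ext (trivialModule ε) (ModuleCat.of B B) d,
      extRightMul e b = c • e := by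
  obtain ⟨e₀, -, he₀⟩ := finrank_eq_one_iff'.1 h.finrank_ext
  obtain ⟨c, hc⟩ := he₀ (extRightMul e₀ b)
  refine ⟨c, fun e => ?_⟩
  obtain ⟨t, rfl⟩ := he₀ e
  rw [smul_comm, hc]
  simp [extRightMul]

lemma IsLeftASGorenstein.eq_of_smul {ε : B →ₐ[k] k} {d : ℕ} (h : IsLeftASGorenstein ε d)
    {c c' : k} (hc : ∀ e : Ext (trivialModule ε) (ModuleCat.of B B) d, c • e = c' • e) :
    c = c' := by
  obtain ⟨e₀, h₀, -⟩ := finrank_eq_one_iff'.1 h.finrank_ext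
  exact smul_left_injective k h₀ (hc e₀)

/-- The character `π₀ : B → k` through which `B` acts from the right on the one-dimensional
left homological integral `Ext^d_B(k, B)`, that is `e * b = π₀ b • e`. -/
def integralCharacter {ε : B →ₐ[k] k} {d : ℕ} (h : IsLeftASGorenstein ε d) : B →ₐ[k] k :=
  have spec := fun b => (h.exists_scalar b).choose_spec
  AlgHom.ofLinearMap
    { toFun := fun b => (h.exists_scalar b).choose
      map_add' := fun x y => h.eq_of_smul fun e => by
        rw [← spec, extRightMul_add, spec, spec, add_smul]
      map_smul' := fun c x => h.eq_of_smul fun e => by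
        rw [← spec, Algebra.smul_def, extRightMul_mul, spec, extRightMul_algebraMap, smul_smul,
          RingHom.id_apply, smul_eq_mul, mul_comm] }
    (h.eq_of_smul fun e => by
      change (h.exists_scalar 1).choose • e = _
      rw [← spec, extRightMul_one, one_smul])
    (fun x y => h.eq_of_smul fun e => by
      change (h.exists_scalar (x * y)).choose • e =
        ((h.exists_scalar x).choose * (h.exists_scalar y).choose) • e
      rw [← spec, extRightMul_mul, spec, spec, smul_smul, mul_comm])

/-- The defining property of `integralCharacter`. -/
lemma extRightMul_eq_integralCharacter_smul {ε : B →ₐ[k] k} {d : ℕ}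
    (h : IsLeftASGorenstein ε d) (e : Ext (trivialModule ε) (ModuleCat.of B B) d) (b : B) :
    extRightMul e b = integralCharacter h b • e :=
  (h.exists_scalar b).choose_spec e

end Gorenstein

section Inner

/-- A self-map of a ring is inner if it is conjugation by a unit. -/
def IsInner {A : Type u} [Ring A] (f : A → A) : Prop :=
  ∃ w : Aˣ, ∀ a, f a = w * a * ↑w⁻¹

end Inner

section Nakayama

variable (k : Type v) [Field k] (A : Type u) [Ring A] [Algebra k A]

/-- `A` as a left module over `A ⊗ Aᵐᵒᵖ`, with `(x ⊗ y) • a = x * a * y`. -/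
def bimoduleSelf : ModuleCat.{u} (A ⊗[k] Aᵐᵒᵖ) :=
  @ModuleCat.of (A ⊗[k] Aᵐᵒᵖ) _ A _ TensorProduct.Algebra.module

variable {k A}

/-- `ν` is a Nakayama automorphism of the algebra `A` of injective dimension `d`: with
`Aᵉ = A ⊗ Aᵐᵒᵖ`, one has `Ext^i_{Aᵉ}(A, Aᵉ) = 0` for `i ≠ d`, and `Ext^d_{Aᵉ}(A, Aᵉ)` is isomorphic
as a bimodule to `¹A^ν`, that is to `A` with `y · a · x = y * a * ν x`. Here the bimodule structure
of `Ext^d_{Aᵉ}(A, Aᵉ)` is `y · e · x = e * (x ⊗ y)`, induced by right multiplication of `Aᵉ`. -/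
structure IsNakayama (d : ℕ) (ν : A ≃ₐ[k] A) : Prop where
  ext_eq_zero : ∀ i : ℕ, i ≠ d →
    Subsingleton (Ext (bimoduleSelf k A) (ModuleCat.of (A ⊗[k] Aᵐᵒᵖ) (A ⊗[k] Aᵐᵒᵖ)) i)
  exists_equiv : ∃ f : Ext (bimoduleSelf k A) (ModuleCat.of (A ⊗[k] Aᵐᵒᵖ) (A ⊗[k] Aᵐᵒᵖ)) d ≃+ A,
    ∀ e (x y : A), f (extRightMul e (x ⊗ₜ[k] op y)) = y * f e * ν x

/-- The smallest positive `n` such that `ν ^ n` is inner, or `⊤` if there is none. For a Nakayama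
automorphism `ν` of `A` this is the Nakayama order of `A`. -/
def outerOrder (ν : A ≃ₐ[k] A) : ℕ∞ :=
  ⨅ (n : ℕ) (_ : 0 < n ∧ IsInner (ν ^ n : A ≃ₐ[k] A)), (n : ℕ∞)

variable (k A) in
/-- Up to isomorphism, `A` has only finitely many left modules of `k`-dimension one. -/
def FinitelyManyOneDimModules : Prop :=
  ∃ (n : ℕ) (L : Fin n → ModuleCat.{u} A),
    ∀ (M : Type u) [AddCommGroup M] [Module k M] [Module A M] [IsScalarTower k A M],
      Module.finrank k M = 1 → ∃ i, Nonempty (M ≃ₗ[A] L i)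

end Nakayama

section Winding

variable {k : Type v} [Field k] {A : Type u} [Ring A] [HopfAlgebra k A]

/-- `a ↦ ∑ π(a₁) a₂`. -/
def leftWindingHom (π : A →ₐ[k] k) : A →ₐ[k] A :=
  ((Algebra.TensorProduct.lid k A).toAlgHom.comp
    (Algebra.TensorProduct.map π (AlgHom.id k A))).comp (Bialgebra.comulAlgHom k A)

/-- `a ↦ ∑ a₁ π(a₂)`. -/
def rightWindingHom (π : A →ₐ[k] k) : A →ₐ[k] A :=
  ((Algebra.TensorProduct.rid k k A).toAlgHom.comp
    (Algebra.TensorProduct.map (AlgHom.id k A) π)).comp (Bialgebra.comulAlgHom k A)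

lemma leftWindingHom_apply (π : A →ₐ[k] k) {a : A} {ι : Type*} (r : Coalgebra.Repr k a ι) :
    leftWindingHom π a = ∑ i ∈ r.index, π (r.left i) • r.right i := by
  simp [leftWindingHom, ← r.eq]

lemma rightWindingHom_apply (π : A →ₐ[k] k) {a : A} {ι : Type*} (r : Coalgebra.Repr k a ι) :
    rightWindingHom π a = ∑ i ∈ r.index, π (r.right i) • r.left i := by
  simp [rightWindingHom, ← r.eq]

/-- The inverse `π ∘ S` of a character `π` under convolution. -/
def characterInv (π : A →ₐ[k] k) : A →ₐ[k] k :=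
  (π.fromOpposite fun _ _ => Commute.all _ _).comp (HopfAlgebra.antipodeAlgHomOp k A)

lemma characterInv_apply (π : A →ₐ[k] k) (a : A) :
    characterInv π a = π (HopfAlgebra.antipode k a) := by
  simp [characterInv]

lemma comul_leftWindingHom (π : A →ₐ[k] k) (a : A) :
    Coalgebra.comul (R := k) (leftWindingHom π a) =
      TensorProduct.map (leftWindingHom π).toLinearMap LinearMap.id (Coalgebra.comul (R := k) a) := by
  let F : A ⊗[k] (A ⊗[k] A) →ₗ[k] A ⊗[k] A :=
    (TensorProduct.lid k (A ⊗[k] A)).toLinearMap ∘ₗ TensorProduct.map π.toLinearMap LinearMap.id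
  have h1 : ∀ x : A ⊗[k] A, F (Coalgebra.comul.lTensor A x) =
      Coalgebra.comul (R := k)
        (TensorProduct.lid k A (TensorProduct.map π.toLinearMap LinearMap.id x)) := fun x => by
    induction x with
    | zero => simp
    | add x y hx hy => simp only [map_add, hx, hy]
    | tmul x y => simp [F]
  have h2 : ∀ (y : A ⊗[k] A) (b : A), F (TensorProduct.assoc k A A A (y ⊗ₜ b)) =
      TensorProduct.lid k A (TensorProduct.map π.toLinearMap LinearMap.id y) ⊗ₜ b := fun y b => by
    induction y with
    | zero => simp
    | add x y hx hy => simp only [map_add, TensorProduct.add_tmul, hx, hy]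
    | tmul x y => simp [F, TensorProduct.smul_tmul']
  have h3 : ∀ x : A ⊗[k] A, F (TensorProduct.assoc k A A A (Coalgebra.comul.rTensor A x)) =
      TensorProduct.map (leftWindingHom π).toLinearMap LinearMap.id x := fun x => by
    induction x with
    | zero => simp
    | add x y hx hy => simp only [map_add, hx, hy]
    | tmul x y => rw [LinearMap.rTensor_tmul, h2]; rfl
  rw [← h3, Coalgebra.coassoc_apply, h1]
  rfl

lemma comul_rightWindingHom (π : A →ₐ[k] k) (a : A) :
    Coalgebra.comul (R := k) (rightWindingHom π a) =
      TensorProduct.map LinearMap.id (rightWindingHom π).toLinearMap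
        (Coalgebra.comul (R := k) a) := by
  let F : A ⊗[k] (A ⊗[k] A) →ₗ[k] A ⊗[k] A :=
    TensorProduct.map LinearMap.id
      ((TensorProduct.rid k A).toLinearMap ∘ₗ TensorProduct.map LinearMap.id π.toLinearMap)
  have h1 : ∀ x : A ⊗[k] A, F (Coalgebra.comul.lTensor A x) =
      TensorProduct.map LinearMap.id (rightWindingHom π).toLinearMap x := fun x => by
    induction x with
    | zero => simp
    | add x y hx hy => simp only [map_add, hx, hy]
    | tmul x y => rfl
  have h2 : ∀ (y : A ⊗[k] A) (b : A), F (TensorProduct.assoc k A A A (y ⊗ₜ b)) = π b • y :=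
    fun y b => by
    induction y with
    | zero => simp
    | add x y hx hy => simp only [map_add, TensorProduct.add_tmul, hx, hy, smul_add]
    | tmul x y => simp [F]
  have h3 : ∀ x : A ⊗[k] A, F (TensorProduct.assoc k A A A (Coalgebra.comul.rTensor A x)) =
      Coalgebra.comul (R := k)
        (TensorProduct.rid k A (TensorProduct.map LinearMap.id π.toLinearMap x)) := fun x => by
    induction x with
    | zero => simp
    | add x y hx hy => simp only [map_add, hx, hy]
    | tmul x y => rw [LinearMap.rTensor_tmul, h2]; simp
  rw [← h1, ← Coalgebra.coassoc_apply, h3]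
  rfl

lemma leftWindingHom_comp_of (π π' : A →ₐ[k] k)
    (h : ∀ a : A, π' (leftWindingHom π a) = Coalgebra.counit (R := k) a) :
    (leftWindingHom π').comp (leftWindingHom π) = AlgHom.id k A := by
  ext a
  let r := Coalgebra.Repr.arbitrary k a
  let r' : Coalgebra.Repr k (leftWindingHom π a) (A × A) :=
    { index := r.index, left := fun i => leftWindingHom π (r.left i), right := r.right,
      eq := by rw [comul_leftWindingHom, ← r.eq]; simp }
  rw [AlgHom.comp_apply, leftWindingHom_apply π' r']
  simp only [r', h]
  exact Coalgebra.sum_counit_smul r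

lemma rightWindingHom_comp_of (π π' : A →ₐ[k] k)
    (h : ∀ a : A, π' (rightWindingHom π a) = Coalgebra.counit (R := k) a) :
    (rightWindingHom π').comp (rightWindingHom π) = AlgHom.id k A := by
  ext a
  let r := Coalgebra.Repr.arbitrary k a
  let r' : Coalgebra.Repr k (rightWindingHom π a) (A × A) :=
    { index := r.index, left := r.left, right := fun i => rightWindingHom π (r.right i),
      eq := by rw [comul_rightWindingHom, ← r.eq]; simp }
  rw [AlgHom.comp_apply, rightWindingHom_apply π' r']
  simp only [r', h]
  have h1 := congrArg (TensorProduct.rid k A) (Coalgebra.sum_tmul_counit_eq r)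
  rwa [map_sum, TensorProduct.rid_tmul, one_smul] at h1

lemma map_sum_mul_antipode (π : A →ₐ[k] k) {a : A} {ι : Type*} (r : Coalgebra.Repr k a ι) :
    ∑ i ∈ r.index, π (r.left i) * π (HopfAlgebra.antipode k (r.right i)) =
      Coalgebra.counit (R := k) a := by
  simpa using congrArg π (HopfAlgebra.sum_mul_antipode_eq_algebraMap_counit r)

lemma map_sum_antipode_mul (π : A →ₐ[k] k) {a : A} {ι : Type*} (r : Coalgebra.Repr k a ι) :
    ∑ i ∈ r.index, π (HopfAlgebra.antipode k (r.left i)) * π (r.right i) =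
      Coalgebra.counit (R := k) a := by
  simpa using congrArg π (HopfAlgebra.sum_antipode_mul_eq_algebraMap_counit r)

/-- The left winding automorphism `a ↦ ∑ π(a₁) a₂` of a character `π`. -/
def leftWinding (π : A →ₐ[k] k) : A ≃ₐ[k] A :=
  AlgEquiv.ofAlgHom (leftWindingHom π) (leftWindingHom (characterInv π))
    (leftWindingHom_comp_of _ _ fun a => by
      rw [leftWindingHom_apply _ (Coalgebra.Repr.arbitrary k a),
        ← map_sum_antipode_mul π (Coalgebra.Repr.arbitrary k a)]
      simp [characterInv_apply])
    (leftWindingHom_comp_of _ _ fun a => by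
      rw [leftWindingHom_apply _ (Coalgebra.Repr.arbitrary k a),
        ← map_sum_mul_antipode π (Coalgebra.Repr.arbitrary k a)]
      simp [characterInv_apply])

/-- The right winding automorphism `a ↦ ∑ a₁ π(a₂)` of a character `π`. -/
def rightWinding (π : A →ₐ[k] k) : A ≃ₐ[k] A :=
  AlgEquiv.ofAlgHom (rightWindingHom π) (rightWindingHom (characterInv π))
    (rightWindingHom_comp_of _ _ fun a => by
      rw [rightWindingHom_apply _ (Coalgebra.Repr.arbitrary k a),
        ← map_sum_mul_antipode π (Coalgebra.Repr.arbitrary k a)]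
      simp [characterInv_apply, mul_comm])
    (rightWindingHom_comp_of _ _ fun a => by
      rw [rightWindingHom_apply _ (Coalgebra.Repr.arbitrary k a),
        ← map_sum_antipode_mul π (Coalgebra.Repr.arbitrary k a)]
      simp [characterInv_apply, mul_comm])

/-- The left winding automorphism `ξ` of the left homological integral. -/
def xi {d : ℕ} (h : IsASGorenstein (Bialgebra.counitAlgHom k A) d) : A ≃ₐ[k] A :=
  leftWinding (integralCharacter h.left)

/-- The right winding automorphism `φ` of the left homological integral. -/
def phi {d : ℕ} (h : IsASGorenstein (Bialgebra.counitAlgHom k A) d) : A ≃ₐ[k] A :=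
  rightWinding (integralCharacter h.left)

/-- The integral order of `A`: the order of `ξ`, or `⊤` if `ξ` has infinite order. -/
def integralOrder {d : ℕ} (h : IsASGorenstein (Bialgebra.counitAlgHom k A) d) : ℕ∞ :=
  ⨅ (n : ℕ) (_ : 0 < n ∧ xi h ^ n = 1), (n : ℕ∞)

end Winding

end

end HopfNakayama

/-! Everything comes from computing `Ext_{Aᵉ}(A, Aᵉ)` twice. Let `δ : A → Aᵉ` be an algebra map such
that `Aᵉ` is free over `A` on both sides with basis a `k`-basis of `1 ⊗ Aᵐᵒᵖ`, and such that the
trivial module induces to the bimodule `A`. Flat base change (`exists_ext_baseChange`) then gives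
`Ext_{Aᵉ}(A, Aᵉ) ≅ Ext_A(k, A) ⊗_A Aᵉ`. This is concentrated in degree `d`, where it is the right
module with character `π₀` induced along `δ`. Such a module is `¹A^ν` as soon as `x ⊗ y ↦ y * ν x`
carries `δ a` to `π₀ a`; this is the criterion `isNakayama_of_baseChange`.

Two choices of `δ` satisfy the criterion. The map `a ↦ ∑ a₁ ⊗ S a₂` gives `ν = S² ξ`, and `a ↦ ∑ S²
a₂ ⊗ S a₁` gives `ν = φ S⁻²`. Nakayama automorphisms are unique up to inner ones
(`IsNakayama.outerClass_eq`), so `S² ξ` and `φ S⁻²` differ by an inner `γ`. Since `S²`, `φ` and `ξ`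
commute, this is the formula `S⁴ = γ φ ξ⁻¹`.

For the orders, `S` conjugates `φ` into `ξ⁻¹`, so `ξⁿ = 1` forces `φⁿ = 1`. Then `S⁴ⁿ = γⁿ` and `(S²
ξ)²ⁿ` are inner, and `o(A)` divides `2 io(A)`. Conversely, inner automorphisms and `S²` preserve the
counit, and a power of `ξ` is determined by its composite with the counit; so if `(S² ξ)ᵐ` is inner
then `ξᵐ = 1`, and `io(A)` divides `o(A)`. If there are finitely many characters, two distinct
powers of `ξ` have the same composite with the counit, so `ξ` has finite order. -/

namespace HopfNakayama

noncomputable section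

/-! ### Finitely supported sums of additive maps, and diagram chases for them. -/

section Combination

variable {ι E F E' F' E'' F'' : Type*}
  [AddCommGroup E] [AddCommGroup F] [AddCommGroup E'] [AddCommGroup F']
  [AddCommGroup E''] [AddCommGroup F'']

/-- `f ↦ ∑ i, c i (f i)` on finitely supported families. -/
def comb (c : ι → E →+ F) : (ι →₀ E) →+ F :=
  Finsupp.liftAddHom c

lemma comb_single (c : ι → E →+ F) (i : ι) (e : E) : comb c (Finsupp.single i e) = c i e := by
  simp [comb]

lemma comb_apply (c : ι → E →+ F) (f : ι →₀ E) : comb c f = f.sum fun i e => c i e := rfl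

lemma comb_mapRange (c : ι → E →+ F) (c' : ι → E' →+ F') (r : E →+ E') (s : F →+ F')
    (h : ∀ i e, c' i (r e) = s (c i e)) (f : ι →₀ E) :
    comb c' (Finsupp.mapRange.addMonoidHom r f) = s (comb c f) := by
  have : (comb c').comp (Finsupp.mapRange.addMonoidHom r) = s.comp (comb c) := by
    ext i e
    simp [comb_single, h]
  exact DFunLike.congr_fun this f

lemma exists_mapRange_eq (r : E →+ E') (g : ι →₀ E') (h : ∀ i, ∃ e, r e = g i) :
    ∃ f : ι →₀ E, Finsupp.mapRange.addMonoidHom r f = g := by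
  classical
  choose e he using h
  -- The chosen preimage of `0` may be nonzero; replacing it by `0` keeps the support finite.
  refine ⟨Finsupp.onFinset g.support (fun i => if g i = 0 then 0 else e i) fun i hi => ?_, ?_⟩
  · rw [Finsupp.mem_support_iff]
    intro h0
    simp [h0] at hi
  · ext i
    by_cases h0 : g i = 0
    · simp [h0]
    · simp [h0, he]

/-- A four-lemma chase: a direct sum of copies of a left exact row is left exact. It passes base
change to the kernel of a presentation. -/
lemma comb_bijective_of_leftExact {c : ι → E →+ F} {c' : ι → E' →+ F'} {c'' : ι → E'' →+ F''}
    {r : E →+ E'} {s : F →+ F'} {r' : E' →+ E''} {s' : F' →+ F''}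
    (h : ∀ i e, c' i (r e) = s (c i e)) (h' : ∀ i e, c'' i (r' e) = s' (c' i e))
    (hr : Function.Injective r) (hs : Function.Injective s)
    (hrr : ∀ e, r' e = 0 → ∃ x, r x = e) (hss : ∀ x, s' (s x) = 0)
    (hc' : Function.Bijective (comb c')) (hc'' : Function.Injective (comb c'')) :
    Function.Bijective (comb c) := by
  refine ⟨fun f g hfg => ?_, fun y => ?_⟩
  · have h1 := congrArg s hfg
    rw [← comb_mapRange c c' r s h, ← comb_mapRange c c' r s h] at h1
    ext i
    exact hr (by simpa using DFunLike.congr_fun (hc'.1 h1) i)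
  · obtain ⟨f, hf⟩ := hc'.2 (s y)
    have h0 : Finsupp.mapRange.addMonoidHom r' f = 0 := hc'' (by
      rw [comb_mapRange c' c'' r' s' h', hf, hss, map_zero])
    obtain ⟨g, rfl⟩ := exists_mapRange_eq r f fun i => hrr _ (by
      simpa using DFunLike.congr_fun h0 i)
    exact ⟨g, hs (by rw [← comb_mapRange c c' r s h, hf])⟩

/-- The dual chase, for cokernels. Only surjectivity is asked of the first column, so that column
may be the zero map onto a vanishing group. -/
lemma comb_bijective_of_rightExact {c : ι → E →+ F} {c' : ι → E' →+ F'} {c'' : ι → E'' →+ F''}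
    {r : E →+ E'} {s : F →+ F'} {r' : E' →+ E''} {s' : F' →+ F''}
    (h : ∀ i e, c' i (r e) = s (c i e)) (h' : ∀ i e, c'' i (r' e) = s' (c' i e))
    (hr : Function.Surjective r') (hs : Function.Surjective s')
    (hrr : ∀ x, r' (r x) = 0) (hss : ∀ e, s' e = 0 → ∃ x, s x = e)
    (hc : Function.Surjective (comb c)) (hc' : Function.Bijective (comb c')) :
    Function.Bijective (comb c'') := by
  refine ⟨(injective_iff_map_eq_zero _).2 fun f hf => ?_, fun y => ?_⟩
  · obtain ⟨g, rfl⟩ := exists_mapRange_eq r' f fun i => hr _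
    rw [comb_mapRange c' c'' r' s' h'] at hf
    obtain ⟨x, hx⟩ := hss _ hf
    obtain ⟨z, rfl⟩ := hc x
    rw [← comb_mapRange c c' r s h] at hx
    rw [← hc'.1 hx]
    ext i
    simp [hrr]
  · obtain ⟨x, rfl⟩ := hs y
    obtain ⟨f, rfl⟩ := hc'.2 x
    exact ⟨Finsupp.mapRange.addMonoidHom r' f, comb_mapRange c' c'' r' s' h' f⟩

end Combination

/-! ### Base change along a ring map, expressed through a basis. -/

section BaseChange

variable {A T : Type u} [Ring A] [Ring T] {ι : Type*}

/-- An additive map `β : E → F` between groups with operators `A` and `T`, semilinear along `δ`,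
which exhibits `F` as the direct sum of the copies `actF (w i) (β E)` of `E`. If `T` is free over
`A` with basis `w`, this says that `F` is the base change of `E` along `δ`. -/
structure IsBaseChange (δ : A →+* T) (w : ι → T) {E F : Type*} [AddCommGroup E] [AddCommGroup F]
    (actE : A → E →+ E) (actF : T → F →+ F) (β : E →+ F) : Prop where
  map_act : ∀ a e, β (actE a e) = actF (δ a) (β e)
  bijective : Function.Bijective (comb fun i => (actF (w i)).comp β)

/-- Left multiplication on a module, as a family of additive maps. -/
abbrev leftAct (R : Type*) (M : Type*) [Ring R] [AddCommGroup M] [Module R M] : R → M →+ M :=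
  fun r => DistribSMul.toAddMonoidHom M r

/-- `extRightMul` as a family of additive maps. -/
def extAct {R : Type u} [Ring R] (M : ModuleCat.{u} R) (n : ℕ) :
    R → Ext M (ModuleCat.of R R) n →+ Ext M (ModuleCat.of R R) n :=
  fun r => AddMonoidHom.mk' (fun e => extRightMul e r) fun _ _ => Ext.add_comp _ _ _ _

@[simp] lemma extAct_apply {R : Type u} [Ring R] (M : ModuleCat.{u} R) (n : ℕ) (r : R)
    (e : Ext M (ModuleCat.of R R) n) : extAct M n r e = extRightMul e r := rfl

lemma extRightMul_precomp {R : Type u} [Ring R] {L M : ModuleCat.{u} R} {p n q : ℕ}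
    (x : Ext L M p) (e : Ext M (ModuleCat.of R R) n) (h : p + n = q) (r : R) :
    extRightMul (x.comp e h) r = x.comp (extRightMul e r) h := by
  subst h
  exact Ext.comp_assoc_of_third_deg_zero _ _ _ _

lemma extRightMul_mk₀ {R : Type u} [Ring R] {M : ModuleCat.{u} R} (f : M ⟶ ModuleCat.of R R)
    (r : R) : extRightMul (Ext.mk₀ f) r =
      Ext.mk₀ (f ≫ ModuleCat.ofHom (LinearMap.toSpanSingleton R R r)) :=
  Ext.mk₀_comp_mk₀ _ _

variable {δ : A →+* T} {w : ι → T} {M N : Type u} [AddCommGroup M] [AddCommGroup N]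
  [Module A M] [Module T N] {j : M →+ N}

/-- The `δ`-semilinear map `(n → A) → (n → T)` is a base change if `δ` is. -/
lemma IsBaseChange.pi (hR : IsBaseChange δ w (leftAct A A) (leftAct T T) δ.toAddMonoidHom)
    (n : ℕ) : IsBaseChange δ w (leftAct A (Fin n → A)) (leftAct T (Fin n → T))
      (δ.toAddMonoidHom.compLeft (Fin n)) := by
  refine ⟨fun a e => by ext; simp, ?_⟩
  have key : ∀ (l : Fin n) (f : ι →₀ (Fin n → A)),
      comb (fun i => (leftAct T T (w i)).comp δ.toAddMonoidHom)
        (Finsupp.mapRange.addMonoidHom (Pi.evalAddMonoidHom _ l) f) =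
      Pi.evalAddMonoidHom (fun _ => T) l (comb (fun i => (leftAct T (Fin n → T) (w i)).comp
        (δ.toAddMonoidHom.compLeft (Fin n))) f) := fun l f =>
    comb_mapRange _ _ _ _ (fun i e => by simp) f
  refine ⟨fun f g hfg => ?_, fun x => ?_⟩
  · ext i l
    have h1 := congrArg (Pi.evalAddMonoidHom (fun _ => T) l) hfg
    rw [← key, ← key] at h1
    simpa using DFunLike.congr_fun (hR.bijective.1 h1) i
  · choose g hg using fun l => hR.bijective.2 (x l)
    refine ⟨∑ l, Finsupp.mapRange.addMonoidHom (AddMonoidHom.single (fun _ => A) l) (g l), ?_⟩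
    funext l
    have h2 : Finsupp.mapRange.addMonoidHom (Pi.evalAddMonoidHom (fun _ => A) l)
        (∑ l, Finsupp.mapRange.addMonoidHom (AddMonoidHom.single (fun _ => A) l) (g l)) = g l := by
      ext i
      simp [Finsupp.finsetSum_apply, Pi.single_apply]
    have h3 := key l (∑ l, Finsupp.mapRange.addMonoidHom (AddMonoidHom.single (fun _ => A) l) (g l))
    rw [h2, hg] at h3
    exact h3.symm

lemma IsBaseChange.span_eq_top (hj : IsBaseChange δ w (leftAct A M) (leftAct T N) j) :
    Submodule.span T (Set.range j) = ⊤ := by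
  refine eq_top_iff.2 fun y _ => ?_
  obtain ⟨f, rfl⟩ := hj.bijective.2 y
  rw [comb_apply]
  exact Submodule.finsuppSum_mem _ _ _ _ fun i _ =>
    Submodule.smul_mem _ _ (Submodule.subset_span ⟨_, rfl⟩)

lemma IsBaseChange.hom_ext (hj : IsBaseChange δ w (leftAct A M) (leftAct T N) j)
    {L : Type*} [AddCommGroup L] [Module T L] {f g : N →ₗ[T] L} (h : ∀ m, f (j m) = g (j m)) :
    f = g :=
  LinearMap.ext_on hj.span_eq_top (by rintro _ ⟨m, rfl⟩; exact h m)

/-- A semilinear map extends along a base change. -/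
lemma IsBaseChange.exists_extension
    (hR : IsBaseChange δ w (leftAct A A) (leftAct T T) δ.toAddMonoidHom)
    (hj : IsBaseChange δ w (leftAct A M) (leftAct T N) j)
    {L : Type*} [AddCommGroup L] [Module T L] (ψ : M →+ L) (hψ : ∀ a m, ψ (a • m) = δ a • ψ m) :
    ∃ Ψ : N →ₗ[T] L, ∀ m, Ψ (j m) = ψ m := by
  let e := AddEquiv.ofBijective _ hj.bijective
  let g : (ι →₀ M) →+ L := comb fun i => (leftAct T L (w i)).comp ψ
  have he : ∀ f, e f = comb (fun i => (leftAct T N (w i)).comp j) f := fun f => rfl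
  -- Writing `t = ∑ w i * δ (a i)` gives `t • j m = ∑ w i • j (a i • m)`, whose coordinates are
  -- explicit. This identity is what makes the coordinatewise map `T`-linear.
  have key : ∀ (t : T) (m : M), g (e.symm (t • j m)) = t • ψ m := by
    intro t m
    obtain ⟨a, rfl⟩ := hR.bijective.2 t
    have h1 : comb (fun i => (leftAct T T (w i)).comp δ.toAddMonoidHom) a • j m =
        e (Finsupp.mapRange.addMonoidHom (AddMonoidHom.mk' (fun x : A => x • m)
          fun x y => add_smul x y m) a) := by
      rw [he]
      refine (comb_mapRange _ _ _ (AddMonoidHom.mk' (fun t : T => t • j m)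
        fun x y => add_smul x y _) (fun i x => ?_) a).symm
      have := hj.map_act x m
      simp only [DistribSMul.toAddMonoidHom_apply] at this
      simp [this, mul_smul]
    rw [h1, AddEquiv.symm_apply_apply]
    refine comb_mapRange _ _ _ (AddMonoidHom.mk' (fun t : T => t • ψ m)
        fun x y => add_smul x y _) (fun i x => ?_) a
    simp [hψ, mul_smul]
  let G : N →+ L := g.comp e.symm.toAddMonoidHom
  have hG : ∀ (t : T) (m : M), G (t • j m) = t • ψ m := key
  have hj1 : ∀ m : M, G (j m) = ψ m := fun m => by simpa using hG 1 m
  have hlin : ∀ x ∈ Submodule.span T (Set.range j), ∀ t : T, G (t • x) = t • G x := fun x hx => by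
    induction hx using Submodule.span_induction with
    | mem x h =>
      obtain ⟨m, rfl⟩ := h
      exact fun t => by rw [hG, hj1]
    | zero => simp
    | add x y _ _ hx hy => exact fun t => by rw [smul_add, map_add, hx, hy, map_add, smul_add]
    | smul r x _ h => exact fun t => by rw [← mul_smul, h, h, mul_smul]
  exact ⟨{ G with map_smul' := fun t x => hlin x (hj.span_eq_top ▸ Submodule.mem_top) t }, hj1⟩

end BaseChange

/-! ### Base change for `Ext` in degree zero. -/

section ExtBaseChange

variable {A T : Type u} [Ring A] [Ring T] {ι : Type*} {δ : A →+* T} {w : ι → T}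

/-- Degree zero elements of `Ext` as linear maps. -/
def extZeroEval {R : Type u} [Ring R] {M : Type u} [AddCommGroup M] [Module R M] (m : M) :
    Ext (ModuleCat.of R M) (ModuleCat.of R R) 0 →+ R :=
  AddMonoidHom.mk' (fun e => (Ext.addEquiv₀ e).hom m) fun _ _ => by simp

lemma extZeroEval_mk₀ {R : Type u} [Ring R] {M : Type u} [AddCommGroup M] [Module R M] (m : M)
    (φ : M →ₗ[R] R) : extZeroEval m (Ext.mk₀ (ModuleCat.ofHom φ)) = φ m := by
  have h := Ext.addEquiv₀.apply_symm_apply (ModuleCat.ofHom φ)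
  rw [Ext.addEquiv₀_symm_apply] at h
  simp [extZeroEval, h]

lemma exists_mk₀_eq {R : Type u} [Ring R] {M : Type u} [AddCommGroup M] [Module R M]
    (e : Ext (ModuleCat.of R M) (ModuleCat.of R R) 0) :
    ∃ φ : M →ₗ[R] R, Ext.mk₀ (ModuleCat.ofHom φ) = e :=
  ⟨(Ext.addEquiv₀ e).hom, Ext.mk₀_addEquiv₀_apply e⟩

lemma extZeroEval_extRightMul {R : Type u} [Ring R] {M : Type u} [AddCommGroup M] [Module R M]
    (m : M) (e : Ext (ModuleCat.of R M) (ModuleCat.of R R) 0) (r : R) :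
    extZeroEval m (extRightMul e r) = extZeroEval m e * r := by
  obtain ⟨φ, rfl⟩ := exists_mk₀_eq e
  rw [extRightMul_mk₀, ← ModuleCat.ofHom_comp, extZeroEval_mk₀, extZeroEval_mk₀]
  simp

variable {M N : Type u} [AddCommGroup M] [AddCommGroup N] [Module A M] [Module T N] {j : M →+ N}

lemma IsBaseChange.extZero_ext (hj : IsBaseChange δ w (leftAct A M) (leftAct T N) j)
    {x y : Ext (ModuleCat.of T N) (ModuleCat.of T T) 0}
    (h : ∀ m, extZeroEval (j m) x = extZeroEval (j m) y) : x = y := by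
  obtain ⟨f, rfl⟩ := exists_mk₀_eq x
  obtain ⟨g, rfl⟩ := exists_mk₀_eq y
  simp only [extZeroEval_mk₀] at h
  rw [hj.hom_ext h]

lemma extZero_ext {x y : Ext (ModuleCat.of A M) (ModuleCat.of A A) 0}
    (h : ∀ m : M, extZeroEval m x = extZeroEval m y) : x = y := by
  obtain ⟨f, rfl⟩ := exists_mk₀_eq x
  obtain ⟨g, rfl⟩ := exists_mk₀_eq y
  simp only [extZeroEval_mk₀] at h
  rw [LinearMap.ext h]

/-- A family of linear forms on a finitely generated module, finitely many nonzero at every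
element, is finitely supported. -/
lemma exists_finsupp_linearMap [Module.Finite A M] (G : M →ₗ[A] (ι →₀ A)) :
    ∃ f : ι →₀ (M →ₗ[A] A), ∀ i m, f i m = G m i := by
  classical
  obtain ⟨s, hs⟩ := (Module.Finite.fg_top : (⊤ : Submodule A M).FG)
  refine ⟨Finsupp.onFinset (s.biUnion fun m => (G m).support)
    (fun i => (Finsupp.lapply i).comp G) fun i hi => ?_, fun i m => rfl⟩
  by_contra h
  refine hi (LinearMap.ext_on hs fun m hm => ?_)
  simp only [Finset.mem_biUnion, not_exists, not_and, Finsupp.mem_support_iff, not_not] at h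
  simpa using h m hm

/-- Linear forms on `M` extend to `N` by `hR`. Conversely, `hL` splits a form on `N`, restricted
along `j`, into `A`-linear components indexed by `ι`, and only finitely many are nonzero because `M`
is finite. The evaluation formula records naturality for later use. -/
lemma exists_ext_zero_baseChange
    (hR : IsBaseChange δ w (leftAct A A) (leftAct T T) δ.toAddMonoidHom)
    (hL : Function.Bijective
      (comb fun i => (AddMonoidHom.mulRight (w i)).comp δ.toAddMonoidHom))
    (hj : IsBaseChange δ w (leftAct A M) (leftAct T N) j) [Module.Finite A M] :
    ∃ β : Ext (ModuleCat.of A M) (ModuleCat.of A A) 0 →+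
        Ext (ModuleCat.of T N) (ModuleCat.of T T) 0,
      IsBaseChange δ w (extAct _ 0) (extAct _ 0) β ∧
      ∀ e m, extZeroEval (j m) (β e) = δ (extZeroEval m e) := by
  have hex : ∀ e : Ext (ModuleCat.of A M) (ModuleCat.of A A) 0,
      ∃ y : Ext (ModuleCat.of T N) (ModuleCat.of T T) 0,
        ∀ m, extZeroEval (j m) y = δ (extZeroEval m e) := fun e => by
    obtain ⟨φ, rfl⟩ := exists_mk₀_eq e
    obtain ⟨Ψ, hΨ⟩ := hR.exists_extension hj (L := T)
      (δ.toAddMonoidHom.comp φ.toAddMonoidHom) fun a m => by simp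
    exact ⟨Ext.mk₀ (ModuleCat.ofHom Ψ), fun m => by
      rw [extZeroEval_mk₀, extZeroEval_mk₀, hΨ]; rfl⟩
  choose b hb using hex
  let β : Ext (ModuleCat.of A M) (ModuleCat.of A A) 0 →+
      Ext (ModuleCat.of T N) (ModuleCat.of T T) 0 :=
    AddMonoidHom.mk' b fun x y => hj.extZero_ext fun m => by simp [hb]
  have hβ : ∀ e m, extZeroEval (j m) (β e) = δ (extZeroEval m e) := hb
  have heval : ∀ f m, extZeroEval (j m) (comb (fun i => (extAct _ 0 (w i)).comp β) f) =
      comb (fun i => (AddMonoidHom.mulRight (w i)).comp δ.toAddMonoidHom)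
        (Finsupp.mapRange.addMonoidHom (extZeroEval m) f) := fun f m =>
    (comb_mapRange _ _ _ _ (fun i e => by simp [extZeroEval_extRightMul, hβ]) f).symm
  refine ⟨β, ⟨fun a e => hj.extZero_ext fun m => ?_, fun f g hfg => ?_, fun y => ?_⟩, hβ⟩
  · simp [hβ, extZeroEval_extRightMul]
  · ext1 i
    refine extZero_ext fun m => ?_
    have h1 := congrArg (extZeroEval (j m)) hfg
    rw [heval, heval] at h1
    simpa using DFunLike.congr_fun (hL.1 h1) i
  -- `e` is a left `A`-linear isomorphism from a direct sum of copies of `A` to `T`, so `e.symm ∘ Ψ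
  -- ∘ j` is `A`-linear and its components are forms on `M`.
  · let e := AddEquiv.ofBijective _ hL
    have he : ∀ (a : A) (x : ι →₀ A), e (a • x) = δ a * e x := fun a x => by
      refine (congrArg e ?_).trans (comb_mapRange (fun i => (AddMonoidHom.mulRight (w i)).comp
        δ.toAddMonoidHom) _ (AddMonoidHom.mulLeft a) (AddMonoidHom.mulLeft (δ a))
        (fun i x => by simp [mul_assoc]) x)
      ext i
      simp
    obtain ⟨Ψ, rfl⟩ := exists_mk₀_eq y
    let G : M →ₗ[A] (ι →₀ A) :=
      { toFun := fun m => e.symm (Ψ (j m))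
        map_add' := fun x y => by simp
        map_smul' := fun a m => e.injective (by
          have := hj.map_act a m
          simp only [DistribSMul.toAddMonoidHom_apply] at this
          simp [he, this]) }
    obtain ⟨f, hf⟩ := exists_finsupp_linearMap G
    refine ⟨Finsupp.mapRange.addMonoidHom (AddMonoidHom.mk'
      (fun φ : M →ₗ[A] A => Ext.mk₀ (ModuleCat.ofHom φ)) fun x y => by
        rw [ModuleCat.ofHom_add, Ext.mk₀_add]) f, hj.extZero_ext fun m => ?_⟩
    rw [heval, extZeroEval_mk₀]
    have : Finsupp.mapRange.addMonoidHom (extZeroEval m) (Finsupp.mapRange.addMonoidHom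
        (AddMonoidHom.mk' (fun φ : M →ₗ[A] A => Ext.mk₀ (ModuleCat.ofHom φ)) fun x y => by
          rw [ModuleCat.ofHom_add, Ext.mk₀_add]) f) = G m := by
      ext i
      simp [extZeroEval_mk₀, hf]
    rw [this]
    exact e.apply_symm_apply _

end ExtBaseChange

/-! ### Dimension shifting and base change for `Ext` in all degrees. -/

section ExtBaseChangeStep

variable {A T : Type u} [Ring A] [Ring T] {ι : Type*} {δ : A →+* T} {w : ι → T}

lemma extZeroEval_precomp {R : Type u} [Ring R] {L M : Type u} [AddCommGroup L] [Module R L]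
    [AddCommGroup M] [Module R M] (g : L →ₗ[R] M) (m : L)
    (e : Ext (ModuleCat.of R M) (ModuleCat.of R R) 0) :
    extZeroEval m ((Ext.mk₀ (ModuleCat.ofHom g)).comp e (zero_add 0)) = extZeroEval (g m) e := by
  obtain ⟨φ, rfl⟩ := exists_mk₀_eq e
  rw [Ext.mk₀_comp_mk₀, ← ModuleCat.ofHom_comp, extZeroEval_mk₀, extZeroEval_mk₀]
  rfl

/-- The inductive step: `Ext^(n+1)` of the quotient is the cokernel of `Ext^n` of the projective
term in `Ext^n` of the kernel. -/
lemma exists_ext_succ_baseChange {S : ShortComplex (ModuleCat.{u} A)}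
    {S' : ShortComplex (ModuleCat.{u} T)} (hS : S.ShortExact) (hS' : S'.ShortExact)
    [Projective S.X₂] [Projective S'.X₂] {n : ℕ}
    {β : Ext S.X₁ (ModuleCat.of A A) n →+ Ext S'.X₁ (ModuleCat.of T T) n}
    (hβ : IsBaseChange δ w (extAct _ n) (extAct _ n) β)
    {β₂ : Ext S.X₂ (ModuleCat.of A A) n →+ Ext S'.X₂ (ModuleCat.of T T) n}
    (hβ₂ : Function.Surjective (comb fun i => (extAct _ n (w i)).comp β₂))
    (hcomp : ∀ e, β ((Ext.mk₀ S.f).comp e (zero_add n)) =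
      (Ext.mk₀ S'.f).comp (β₂ e) (zero_add n)) :
    ∃ γ : Ext S.X₃ (ModuleCat.of A A) (n + 1) →+ Ext S'.X₃ (ModuleCat.of T T) (n + 1),
      IsBaseChange δ w (extAct _ (n + 1)) (extAct _ (n + 1)) γ := by
  let r := hS.extClass.precomp (ModuleCat.of A A) (add_comm 1 n)
  let s := hS'.extClass.precomp (ModuleCat.of T T) (add_comm 1 n)
  have hr : Function.Surjective r := fun x =>
    Ext.contravariant_sequence_exact₃ hS _ x (Ext.eq_zero_of_projective _) (add_comm 1 n)
  have hs : Function.Surjective s := fun x =>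
    Ext.contravariant_sequence_exact₃ hS' _ x (Ext.eq_zero_of_projective _) (add_comm 1 n)
  have hs0 : ∀ x, s ((Ext.mk₀ S'.f).comp x (zero_add n)) = 0 := fun x => by
    simp [s, ShortComplex.ShortExact.extClass_comp_assoc]
  -- By exactness the kernel of the connecting map `r` comes from the projective term, where `hcomp`
  -- applies; hence `s ∘ β` descends along `r` to `γ`.
  have hker : r.ker ≤ (s.comp β).ker := fun x hx => by
    obtain ⟨y, rfl⟩ := Ext.contravariant_sequence_exact₁ hS _ x (add_comm 1 n) hx
    rw [AddMonoidHom.mem_ker, AddMonoidHom.comp_apply, hcomp, hs0]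
  let γ := AddMonoidHom.liftOfSurjective r hr ⟨s.comp β, hker⟩
  have hγ : ∀ x, γ (r x) = s (β x) :=
    AddMonoidHom.liftOfRightInverse_comp_apply r _ (Function.rightInverse_surjInv hr) ⟨_, hker⟩
  have hract : ∀ a x, extRightMul (r x) a = r (extRightMul x a) := fun a x =>
    extRightMul_precomp _ _ (add_comm 1 n) _
  have hsact : ∀ a x, extRightMul (s x) a = s (extRightMul x a) := fun a x =>
    extRightMul_precomp _ _ (add_comm 1 n) _
  refine ⟨γ, fun a e => ?_, ?_⟩
  · obtain ⟨e, rfl⟩ := hr e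
    have := hβ.map_act a e
    simp only [extAct_apply] at this
    simp [hract, hγ, hsact, this]
  · exact comb_bijective_of_rightExact (r := (Ext.mk₀ S.f).precomp _ (zero_add n))
      (s := (Ext.mk₀ S'.f).precomp _ (zero_add n)) (r' := r) (s' := s)
      (fun i e => by simp [hcomp, extRightMul_precomp])
      (fun i e => by simp [hγ, hsact]) hr hs
      (fun x => by simp [r, ShortComplex.ShortExact.extClass_comp_assoc])
      (fun e he => Ext.contravariant_sequence_exact₁ hS' _ e (add_comm 1 n) he)
      hβ₂ hβ.bijective

/-- **Flat base change for `Ext(-, A)`**: if `T` is free with basis `w` as a left and as a right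
`A`-module, `A` is left noetherian and `N` is the base change of the finite module `M`, then
`Ext^n_T(N, T)` is the base change of `Ext^n_A(M, A)`. -/
theorem exists_ext_baseChange [IsNoetherianRing A]
    (hR : IsBaseChange δ w (leftAct A A) (leftAct T T) δ.toAddMonoidHom)
    (hL : Function.Bijective
      (comb fun i => (AddMonoidHom.mulRight (w i)).comp δ.toAddMonoidHom)) (n : ℕ) :
    ∀ {M N : Type u} [AddCommGroup M] [AddCommGroup N] [Module A M] [Module T N] {j : M →+ N}
      [Module.Finite A M], IsBaseChange δ w (leftAct A M) (leftAct T N) j →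
    ∃ β : Ext (ModuleCat.of A M) (ModuleCat.of A A) n →+
        Ext (ModuleCat.of T N) (ModuleCat.of T T) n,
      IsBaseChange δ w (extAct _ n) (extAct _ n) β := by
  induction n with
  | zero =>
    intro M N _ _ _ _ j _ hj
    obtain ⟨β, hβ, -⟩ := exists_ext_zero_baseChange hR hL hj
    exact ⟨β, hβ⟩
  | succ n ih =>
    intro M N _ _ _ _ j _ hj
    obtain ⟨m, p, hp⟩ := Module.Finite.exists_fin' A M
    have hP := hR.pi m
    obtain ⟨q, hq⟩ := hR.exists_extension hP (L := N) (j.comp p.toAddMonoidHom) fun a x => by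
      simpa using hj.map_act a (p x)
    replace hq : ∀ x, q (δ.toAddMonoidHom.compLeft (Fin m) x) = j (p x) := hq
    have hqs : Function.Surjective q := by
      rw [← LinearMap.range_eq_top, eq_top_iff, ← hj.span_eq_top, Submodule.span_le]
      rintro _ ⟨x, rfl⟩
      obtain ⟨y, rfl⟩ := hp x
      exact ⟨_, hq y⟩
    let jK : LinearMap.ker p →+ LinearMap.ker q :=
      AddMonoidHom.mk' (fun x => ⟨δ.toAddMonoidHom.compLeft (Fin m) x, by
        rw [LinearMap.mem_ker, hq, LinearMap.mem_ker.1 x.2, map_zero]⟩) fun x y => by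
          ext1; exact map_add _ _ _
    have hjK : ∀ x, (jK x : Fin m → T) = δ.toAddMonoidHom.compLeft (Fin m) x := fun x => rfl
    have hK : IsBaseChange δ w (leftAct A (LinearMap.ker p)) (leftAct T (LinearMap.ker q)) jK := by
      refine ⟨fun a x => Subtype.ext (hP.map_act a x), ?_⟩
      exact comb_bijective_of_leftExact (r := (LinearMap.ker p).subtype.toAddMonoidHom)
        (s := (LinearMap.ker q).subtype.toAddMonoidHom) (r' := p.toAddMonoidHom)
        (s' := q.toAddMonoidHom) (fun i e => rfl)
        (fun i e => by simpa using congrArg (w i • ·) (hq e).symm)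
        Subtype.val_injective Subtype.val_injective (fun e he => ⟨⟨e, he⟩, rfl⟩)
        (fun x => x.2) hP.bijective hj.bijective.1
    have hS := LinearMap.shortExact_shortComplexKer hp
    have hS' := LinearMap.shortExact_shortComplexKer hqs
    have : Module.Finite A (LinearMap.ker p) := inferInstance
    -- `Ext⁰` of the free term does not vanish in general, so reaching degree one requires
    -- compatible maps in degree zero. Above that the free term has no `Ext`, and `0` serves as
    -- `β₂`.
    cases n with
    | zero =>
      obtain ⟨β, hβ, hβe⟩ := exists_ext_zero_baseChange hR hL hK
      obtain ⟨β₂, hβ₂, hβ₂e⟩ := exists_ext_zero_baseChange hR hL hP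
      refine exists_ext_succ_baseChange hS hS' hβ hβ₂.bijective.2 fun e =>
        hK.extZero_ext fun x => ?_
      rw [hβe]
      refine Eq.trans ?_ (extZeroEval_precomp (LinearMap.ker q).subtype (jK x) (β₂ e)).symm
      refine (congrArg δ (extZeroEval_precomp (LinearMap.ker p).subtype x e)).trans ?_
      exact (hβ₂e e x.1).symm
    | succ n =>
      obtain ⟨β, hβ⟩ := ih hK
      have h1 := Ext.subsingleton_of_projective (ModuleCat.of A (Fin m → A)) (ModuleCat.of A A) n
      have h2 := Ext.subsingleton_of_projective (ModuleCat.of T (Fin m → T)) (ModuleCat.of T T) n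
      exact exists_ext_succ_baseChange hS hS' hβ (β₂ := 0)
        (fun x => ⟨0, h2.elim _ _⟩) fun e => by
          rw [show e = 0 from h1.elim _ _]
          simp

end ExtBaseChangeStep

/-! ### `Ext` of the module induced from the trivial module. -/

section TrivialModule

variable {k : Type v} [Field k] {A T : Type u} [Ring A] [Algebra k A] [Ring T] [Algebra k T]
  {ι : Type*} {δ : A →ₐ[k] T} {w : ι → T}

/-- The structure of `Ext_T(N, T)` for the base change `N` of the trivial module of an
Artin-Schelter Gorenstein algebra: it is concentrated in degree `d`, where it is the base change of
the right module `k` along `integralCharacter`. -/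
theorem ext_baseChange_trivialModule [IsNoetherianRing A] {ε : A →ₐ[k] k} {d : ℕ}
    (h : IsLeftASGorenstein ε d)
    (hR : IsBaseChange δ.toRingHom w (leftAct A A) (leftAct T T) δ.toRingHom.toAddMonoidHom)
    (hL : Function.Bijective
      (comb fun i => (AddMonoidHom.mulRight (w i)).comp δ.toRingHom.toAddMonoidHom))
    {N : Type u} [AddCommGroup N] [Module T N]
    {j : A ⧸ (RingHom.ker ε : Submodule A A) →+ N}
    (hj : IsBaseChange δ.toRingHom w (leftAct A _) (leftAct T N) j) :
    (∀ i : ℕ, i ≠ d → Subsingleton (Ext (ModuleCat.of T N) (ModuleCat.of T T) i)) ∧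
    ∃ e₀ : Ext (ModuleCat.of T N) (ModuleCat.of T T) d,
      (∀ y, ∃ t, extRightMul e₀ t = y) ∧
      ∀ f : ι →₀ A, extRightMul e₀ (comb (fun i => (AddMonoidHom.mulRight (w i)).comp
        δ.toRingHom.toAddMonoidHom) f) = 0 ↔ ∀ i, integralCharacter h (f i) = 0 := by
  refine ⟨fun i hi => ?_, ?_⟩
  · obtain ⟨β, hβ⟩ : ∃ β : Ext (trivialModule ε) (ModuleCat.of A A) i →+ _,
        IsBaseChange _ w (extAct (trivialModule ε) i) (extAct (ModuleCat.of T N) i) β :=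
      exists_ext_baseChange hR hL i hj
    have := h.ext_eq_zero i hi
    refine ⟨fun x y => ?_⟩
    obtain ⟨f, rfl⟩ := hβ.bijective.2 x
    obtain ⟨g, rfl⟩ := hβ.bijective.2 y
    congr 1
    ext1 l
    exact this.elim _ _
  · obtain ⟨β, hβ⟩ : ∃ β : Ext (trivialModule ε) (ModuleCat.of A A) d →+ _,
        IsBaseChange _ w (extAct (trivialModule ε) d) (extAct (ModuleCat.of T N) d) β :=
      exists_ext_baseChange hR hL d hj
    obtain ⟨e, he0, he⟩ := finrank_eq_one_iff'.1 h.finrank_ext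
    have hact : ∀ a, extRightMul (β e) (δ a) = β (integralCharacter h a • e) := fun a => by
      rw [← extRightMul_eq_integralCharacter_smul]
      exact (hβ.map_act a e).symm
    -- The coordinates of `β e * ∑ δ (f i) * w i` are the multiples `π₀ (f i) • e`. Both
    -- surjectivity and the annihilator of `e₀ = β e` are read off from this.
    have hcomb : ∀ f : ι →₀ A, extRightMul (β e) (comb (fun i =>
        (AddMonoidHom.mulRight (w i)).comp δ.toRingHom.toAddMonoidHom) f) =
        comb (fun i => (extAct _ d (w i)).comp β) (Finsupp.mapRange.addMonoidHom
          (AddMonoidHom.mk' (fun a => integralCharacter h a • e) fun x y => by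
            rw [map_add, add_smul]) f) := fun f =>
      (comb_mapRange _ _ _ (AddMonoidHom.mk' (fun t => extRightMul (β e) t)
        fun x y => extRightMul_add _ _ _) (fun i a => by simp [extRightMul_mul, hact]) f).symm
    refine ⟨β e, fun y => ?_, fun f => ?_⟩
    · obtain ⟨f, rfl⟩ := hβ.bijective.2 y
      obtain ⟨g, rfl⟩ := exists_mapRange_eq (AddMonoidHom.mk'
        (fun a => integralCharacter h a • e) fun x y => by rw [map_add, add_smul]) f fun i => by
          obtain ⟨c, hc⟩ := he (f i)
          exact ⟨algebraMap k A c, by simpa using hc⟩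
      exact ⟨_, hcomb g⟩
    · rw [hcomb, map_eq_zero_iff _ hβ.bijective.1, Finsupp.ext_iff]
      refine forall_congr' fun i => ?_
      simp only [Finsupp.mapRange.addMonoidHom_apply, Finsupp.mapRange_apply, Finsupp.coe_zero,
        Pi.zero_apply]
      exact smul_eq_zero.trans (or_iff_left he0)

end TrivialModule

/-! ### Bases of tensor products as finitely supported sums. -/

section Tensor

variable {k : Type v} [Field k] {A B : Type*} [Ring A] [Algebra k A] [AddCommGroup B] [Module k B]
  {ι : Type*} {F : Type*} [AddCommGroup F] [Module k F]

lemma comb_eq_tensor (b : Module.Basis ι k B) (Θ : A ⊗[k] B →ₗ[k] F) (c : ι → A →+ F)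
    (hc : ∀ i a, c i a = Θ (a ⊗ₜ b i)) (f : ι →₀ A) :
    haveI := Classical.decEq ι
    comb c f = Θ ((TensorProduct.equivFinsuppOfBasisRight b).symm f) := by
  classical
  rw [TensorProduct.equivFinsuppOfBasisRight_symm_apply, comb_apply, map_finsuppSum]
  simp only [hc]

lemma comb_bijective_of_tensor (b : Module.Basis ι k B) (Θ : A ⊗[k] B →ₗ[k] F)
    (hΘ : Function.Bijective Θ) (c : ι → A →+ F) (hc : ∀ i a, c i a = Θ (a ⊗ₜ b i)) :
    Function.Bijective (comb c) := by
  classical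
  have : ⇑(comb c) = Θ ∘ (TensorProduct.equivFinsuppOfBasisRight b).symm :=
    funext fun f => comb_eq_tensor b Θ c hc f
  rw [this]
  exact hΘ.comp (LinearEquiv.bijective _)

end Tensor

/-! ### A criterion for Nakayama automorphisms. -/

section Bimodule

variable {k : Type v} [Field k] {A : Type u} [Ring A] [Algebra k A]

/-- The map `x ⊗ y ↦ y * ν x` of `A ⊗ Aᵐᵒᵖ` to `A`. -/
def twistedMul (ν : A →ₐ[k] A) : A ⊗[k] Aᵐᵒᵖ →ₗ[k] A :=
  TensorProduct.lift ((LinearMap.mul k A).flip.compl₂ (opLinearEquiv k).symm.toLinearMap ∘ₗ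
    ν.toLinearMap)

@[simp] lemma twistedMul_tmul (ν : A →ₐ[k] A) (x : A) (y : Aᵐᵒᵖ) :
    twistedMul ν (x ⊗ₜ y) = unop y * ν x := rfl

/-- The map `x ⊗ y ↦ x * y` of `A ⊗ Aᵐᵒᵖ` to `A`. -/
def mulUnop : A ⊗[k] Aᵐᵒᵖ →ₗ[k] A :=
  TensorProduct.lift ((LinearMap.mul k A).compl₂ (opLinearEquiv k).symm.toLinearMap)

@[simp] lemma mulUnop_tmul (x : A) (y : Aᵐᵒᵖ) :
    mulUnop (k := k) (x ⊗ₜ y) = x * unop y := rfl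

lemma twistedMul_mul_tmul (ν : A →ₐ[k] A) (t : A ⊗[k] Aᵐᵒᵖ) (x y : A) :
    twistedMul ν (t * x ⊗ₜ op y) = y * twistedMul ν t * ν x := by
  induction t with
  | zero => simp
  | add s t hs ht => rw [add_mul, map_add, hs, ht, map_add, mul_add, add_mul]
  | tmul a b => simp [mul_assoc]

/-- A criterion for Nakayama automorphisms: the enveloping algebra is free on both sides over `A`
along `δ`, with basis given by `1 ⊗ A`, the trivial module is induced to `A`, and `ν` is compatible
with the character of the left homological integral. -/
theorem isNakayama_of_baseChange [IsNoetherianRing A] {ε : A →ₐ[k] k} {d : ℕ}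
    (h : IsLeftASGorenstein ε d) (δ : A →ₐ[k] A ⊗[k] Aᵐᵒᵖ) (ν : A ≃ₐ[k] A)
    {ΘR ΘL : A ⊗[k] A →ₗ[k] A ⊗[k] Aᵐᵒᵖ}
    (hΘR : Function.Bijective ΘR) (hΘRδ : ∀ a y, ΘR (a ⊗ₜ y) = (1 : A) ⊗ₜ op y * δ a)
    (hΘL : Function.Bijective ΘL) (hΘLδ : ∀ a y, ΘL (a ⊗ₜ y) = δ a * (1 : A) ⊗ₜ op y)
    (hε : ∀ a, mulUnop (δ a) = algebraMap k A (ε a))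
    (hν : ∀ a, twistedMul (ν : A →ₐ[k] A) (δ a) = algebraMap k A (integralCharacter h a)) :
    IsNakayama d ν := by
  classical
  let b := Module.Basis.ofVectorSpace k A
  let w := fun i => (1 : A) ⊗ₜ[k] op (b i)
  let _ : Module (A ⊗[k] Aᵐᵒᵖ) A := TensorProduct.Algebra.module
  have hsmul : ∀ (x y c : A), (x ⊗ₜ[k] op y) • c = x * (c * y) := fun x y c => rfl
  have hδ : ∀ (t : A ⊗[k] Aᵐᵒᵖ) (c : k), t • algebraMap k A c = c • mulUnop t := fun t c => by
    induction t with
    | zero => rw [map_zero, smul_zero]; exact zero_smul (A ⊗[k] Aᵐᵒᵖ) (algebraMap k A c)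
    | add s t hs ht => rw [add_smul, map_add, hs, ht, smul_add]
    | tmul x y =>
      refine (hsmul x (unop y) _).trans ?_
      rw [mulUnop_tmul, ← Algebra.smul_def, mul_smul_comm]
  have hR : IsBaseChange δ.toRingHom w (leftAct A A) (leftAct _ _)
      δ.toRingHom.toAddMonoidHom :=
    ⟨fun a e => by simp, comb_bijective_of_tensor b ΘR hΘR _ fun i a => (hΘRδ a (b i)).symm⟩
  have hL := comb_bijective_of_tensor b ΘL hΘL
    (fun i => (AddMonoidHom.mulRight (w i)).comp δ.toRingHom.toAddMonoidHom)
    fun i a => (hΘLδ a (b i)).symm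
  let j : A ⧸ (RingHom.ker ε : Submodule A A) →+ A :=
    QuotientAddGroup.lift _ ((algebraMap k A).comp ε.toRingHom).toAddMonoidHom fun x hx => by
      have : ε x = 0 := hx
      simp [this]
  have hjmk : ∀ x : A, j (Submodule.Quotient.mk x) = algebraMap k A (ε x) := fun x => rfl
  have hjact : ∀ (t : A ⊗[k] Aᵐᵒᵖ) (x : A), t • j (Submodule.Quotient.mk x) = ε x • mulUnop t :=
    fun t x => by rw [hjmk, hδ]
  have hj : IsBaseChange δ.toRingHom w (leftAct A _) (leftAct (A ⊗[k] Aᵐᵒᵖ) A) j := by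
    refine ⟨fun a e => ?_, ?_⟩
    · obtain ⟨x, rfl⟩ := Submodule.Quotient.mk_surjective _ e
      refine Eq.trans ?_ (hjact (δ a) x).symm
      refine (hjmk (a * x)).trans ?_
      rw [hε, map_mul, mul_comm, map_mul, ← Algebra.smul_def]
    -- Under the identification `q` of `k` with the trivial module, the map to be inverted is the
    -- expansion of elements of `A` in the basis `b`.
    · let q : k →+ A ⧸ (RingHom.ker ε : Submodule A A) :=
        (Submodule.mkQ _).toAddMonoidHom.comp (algebraMap k A).toAddMonoidHom
      have hq : Function.Bijective q := by
        refine ⟨(injective_iff_map_eq_zero _).2 fun c hc => ?_, fun e => ?_⟩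
        · have h1 := (Submodule.Quotient.mk_eq_zero _).1 hc
          simpa using (RingHom.mem_ker (f := ε)).1 h1
        · obtain ⟨x, rfl⟩ := Submodule.Quotient.mk_surjective _ e
          refine ⟨ε x, (Submodule.Quotient.eq _).2 ((RingHom.mem_ker (f := ε)).2 ?_)⟩
          simp
      have hcomb : ∀ f : _ →₀ k, comb (fun i => (leftAct (A ⊗[k] Aᵐᵒᵖ) A (w i)).comp j)
          (Finsupp.mapRange.addMonoidHom q f) = b.repr.symm f := fun f => by
        rw [Module.Basis.repr_symm_apply, Finsupp.linearCombination_apply]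
        refine comb_mapRange (fun i => (LinearMap.toSpanSingleton k A (b i)).toAddMonoidHom)
          _ q (AddMonoidHom.id A) (fun i c => ?_) f
        refine (hjact (w i) (algebraMap k A c)).trans ?_
        simp [w]
      refine ⟨fun f g hfg => ?_, fun y => ?_⟩
      · obtain ⟨f, rfl⟩ := exists_mapRange_eq q f fun i => hq.2 _
        obtain ⟨g, rfl⟩ := exists_mapRange_eq q g fun i => hq.2 _
        rw [hcomb, hcomb] at hfg
        rw [b.repr.symm.injective hfg]
      · exact ⟨_, (hcomb (b.repr y)).trans (b.repr.symm_apply_apply y)⟩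
  obtain ⟨h0, e₀, hsurj, hker⟩ := ext_baseChange_trivialModule h hR hL hj
  -- By `hν`, `twistedMul` sends `∑ δ (f i) * w i` to `∑ π₀ (f i) • b i`. Its kernel is therefore
  -- the annihilator of `e₀`, so `e₀ * t ↦ twistedMul ν t` is well defined and injective.
  have htw : ∀ f : _ →₀ A, twistedMul (ν : A →ₐ[k] A) (comb (fun i =>
      (AddMonoidHom.mulRight (w i)).comp δ.toRingHom.toAddMonoidHom) f) =
      b.repr.symm (Finsupp.mapRange.addMonoidHom
        (integralCharacter h).toRingHom.toAddMonoidHom f) := fun f => by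
    rw [Module.Basis.repr_symm_apply, Finsupp.linearCombination_apply]
    refine (comb_mapRange _ (fun i => (LinearMap.toSpanSingleton k A (b i)).toAddMonoidHom) _
      (twistedMul (ν : A →ₐ[k] A)).toAddMonoidHom (fun i a => ?_) f).symm
    refine Eq.trans ?_ (twistedMul_mul_tmul (ν : A →ₐ[k] A) (δ a) 1 (b i)).symm
    rw [hν, map_one, mul_one, ← Algebra.commutes, ← Algebra.smul_def]
    rfl
  have hker' : ∀ t, extRightMul e₀ t = 0 ↔ twistedMul (ν : A →ₐ[k] A) t = 0 := fun t => by
    obtain ⟨f, rfl⟩ := hL.2 t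
    rw [hker, htw, map_eq_zero_iff _ b.repr.symm.injective, Finsupp.ext_iff]
    rfl
  let φ := AddMonoidHom.mk' (fun t => extRightMul e₀ t) fun x y => extRightMul_add e₀ x y
  have hφ : Function.Surjective φ := hsurj
  let g := AddMonoidHom.liftOfSurjective φ hφ
    ⟨(twistedMul (ν : A →ₐ[k] A)).toAddMonoidHom, fun t ht => (hker' t).1 ht⟩
  have hg : ∀ t, g (extRightMul e₀ t) = twistedMul (ν : A →ₐ[k] A) t :=
    AddMonoidHom.liftOfRightInverse_comp_apply φ _ (Function.rightInverse_surjInv hφ) ⟨_, _⟩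
  have hgbij : Function.Bijective g := by
    refine ⟨(injective_iff_map_eq_zero _).2 fun e he => ?_, 
      fun y => ⟨extRightMul e₀ (1 ⊗ₜ op y), ?_⟩⟩
    · obtain ⟨t, rfl⟩ := hsurj e
      rwa [hg, ← hker'] at he
    · simp [hg]
  refine ⟨h0, AddEquiv.ofBijective g hgbij, fun e x y => ?_⟩
  obtain ⟨t, rfl⟩ := hsurj e
  have := extRightMul_mul e₀ t (x ⊗ₜ op y)
  change g (extRightMul (extRightMul e₀ t) (x ⊗ₜ op y)) = y * g (extRightMul e₀ t) * ν x
  rw [← this, hg, hg, twistedMul_mul_tmul]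
  rfl

end Bimodule

/-! ### Invertible twists of `A ⊗ A` by convolution. -/

section Twist

variable {k : Type v} [Field k] {A : Type u} [AddCommGroup A] [Module k A] [Coalgebra k A]

/-- The map `a ⊗ y ↦ ∑ a₁ ⊗ f a₂ y`. -/
def twistRight (f : A →ₗ[k] A →ₗ[k] A) : A ⊗[k] A →ₗ[k] A ⊗[k] A :=
  (TensorProduct.lift f).lTensor A ∘ₗ (TensorProduct.assoc k A A A).toLinearMap ∘ₗ
    (Coalgebra.comul (R := k) (A := A)).rTensor A

/-- The map `a ⊗ y ↦ ∑ a₂ ⊗ f a₁ y`. -/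
def twistLeft (f : A →ₗ[k] A →ₗ[k] A) : A ⊗[k] A →ₗ[k] A ⊗[k] A :=
  (TensorProduct.lift f).lTensor A ∘ₗ (TensorProduct.assoc k A A A).toLinearMap ∘ₗ
    ((TensorProduct.comm k A A).toLinearMap ∘ₗ Coalgebra.comul (R := k) (A := A)).rTensor A

lemma twistRight_tmul (f : A →ₗ[k] A →ₗ[k] A) {a : A} {ι : Type*} (r : Coalgebra.Repr k a ι)
    (y : A) : twistRight f (a ⊗ₜ y) = ∑ i ∈ r.index, r.left i ⊗ₜ f (r.right i) y := by
  simp [twistRight, ← r.eq, TensorProduct.sum_tmul]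

lemma twistLeft_tmul (f : A →ₗ[k] A →ₗ[k] A) {a : A} {ι : Type*} (r : Coalgebra.Repr k a ι)
    (y : A) : twistLeft f (a ⊗ₜ y) = ∑ i ∈ r.index, r.right i ⊗ₜ f (r.left i) y := by
  simp [twistLeft, ← r.eq, TensorProduct.sum_tmul]

/-- `f * g = ε` under the convolution induced by composition. -/
def IsConvInverse (f g : A →ₗ[k] A →ₗ[k] A) : Prop :=
  ∀ (a y : A) (r : Coalgebra.Repr k a (A × A)),
    ∑ i ∈ r.index, f (r.left i) (g (r.right i) y) = Coalgebra.counit (R := k) a • y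

/-- `f * g = ε` under the opposite convolution. -/
def IsOpConvInverse (f g : A →ₗ[k] A →ₗ[k] A) : Prop :=
  ∀ (a y : A) (r : Coalgebra.Repr k a (A × A)),
    ∑ i ∈ r.index, f (r.right i) (g (r.left i) y) = Coalgebra.counit (R := k) a • y

/-- Coassociativity turns the double twist into `∑ a₁ ⊗ f a₂ (g a₃ y)`, and the inner convolution
collapses to the counit. -/
lemma twistRight_twistRight {f g : A →ₗ[k] A →ₗ[k] A} (h : IsConvInverse f g) (z : A ⊗[k] A) :
    twistRight f (twistRight g z) = z := by
  induction z with
  | zero => simp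
  | add x y hx hy => rw [map_add, map_add, hx, hy]
  | tmul a y =>
    let r := Coalgebra.Repr.arbitrary k a
    have h1 := congrArg ((TensorProduct.lift (f.compl₂ (g.flip y))).lTensor A)
      (Coalgebra.sum_tmul_tmul_eq r (fun i => Coalgebra.Repr.arbitrary k (r.left i))
        (fun i => Coalgebra.Repr.arbitrary k (r.right i)))
    simp only [map_sum, LinearMap.lTensor_tmul, TensorProduct.lift.tmul, LinearMap.compl₂_apply,
      LinearMap.flip_apply] at h1
    rw [twistRight_tmul g r, map_sum]
    simp only [fun i => twistRight_tmul f (Coalgebra.Repr.arbitrary k (r.left i))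
      (g (r.right i) y)]
    rw [h1]
    simp only [← TensorProduct.tmul_sum, fun i => h _ y (Coalgebra.Repr.arbitrary k (r.right i))]
    simp only [← TensorProduct.smul_tmul, ← TensorProduct.sum_tmul]
    have h2 := congrArg (TensorProduct.rid k A) (Coalgebra.sum_tmul_counit_eq r)
    simp only [map_sum, TensorProduct.rid_tmul, one_smul] at h2
    rw [h2]

lemma twistLeft_twistLeft {f g : A →ₗ[k] A →ₗ[k] A} (h : IsOpConvInverse f g) (z : A ⊗[k] A) :
    twistLeft f (twistLeft g z) = z := by
  induction z with
  | zero => simp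
  | add x y hx hy => rw [map_add, map_add, hx, hy]
  | tmul a y =>
    let r := Coalgebra.Repr.arbitrary k a
    have h1 := congrArg (((TensorProduct.lift (f.compl₂ (g.flip y)).flip).lTensor A ∘ₗ
      (TensorProduct.comm k (A ⊗[k] A) A).toLinearMap) ∘ₗ
        (TensorProduct.assoc k A A A).symm.toLinearMap)
      (Coalgebra.sum_tmul_tmul_eq r (fun i => Coalgebra.Repr.arbitrary k (r.left i))
        (fun i => Coalgebra.Repr.arbitrary k (r.right i)))
    simp only [map_sum, LinearMap.comp_apply, LinearEquiv.coe_coe, TensorProduct.assoc_symm_tmul,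
      TensorProduct.comm_tmul, LinearMap.lTensor_tmul, TensorProduct.lift.tmul,
      LinearMap.compl₂_apply, LinearMap.flip_apply] at h1
    rw [twistLeft_tmul g r, map_sum]
    simp only [fun i => twistLeft_tmul f (Coalgebra.Repr.arbitrary k (r.right i))
      (g (r.left i) y)]
    rw [← h1]
    simp only [← TensorProduct.tmul_sum, fun i => h _ y (Coalgebra.Repr.arbitrary k (r.left i))]
    simp only [← TensorProduct.smul_tmul, ← TensorProduct.sum_tmul]
    rw [Coalgebra.sum_counit_smul r]

lemma twistRight_bijective {f g : A →ₗ[k] A →ₗ[k] A} (h : IsConvInverse f g)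
    (h' : IsConvInverse g f) : Function.Bijective (twistRight f) :=
  Function.bijective_iff_has_inverse.2
    ⟨twistRight g, twistRight_twistRight h', twistRight_twistRight h⟩

lemma twistLeft_bijective {f g : A →ₗ[k] A →ₗ[k] A} (h : IsOpConvInverse f g)
    (h' : IsOpConvInverse g f) : Function.Bijective (twistLeft f) :=
  Function.bijective_iff_has_inverse.2
    ⟨twistLeft g, twistLeft_twistLeft h', twistLeft_twistLeft h⟩

end Twist

/-! ### The two embeddings of `A` in its enveloping algebra. -/

section Hopf

open HopfAlgebra

variable {k : Type v} [Field k] {A : Type u} [Ring A] [HopfAlgebra k A]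

lemma antipode_algebraMap (c : k) : antipode k (algebraMap k A c) = algebraMap k A c := by
  rw [Algebra.algebraMap_eq_smul_one, map_smul, antipode_one]

lemma sum_antipode_antipode_mul_antipode {a : A} {ι : Type*} (r : Coalgebra.Repr k a ι) :
    ∑ i ∈ r.index, antipode k (antipode k (r.right i)) * antipode k (r.left i) =
      algebraMap k A (Coalgebra.counit a) := by
  rw [← antipode_algebraMap, ← sum_mul_antipode_eq_algebraMap_counit r, map_sum]
  simp only [antipode_mul_antidistrib]

lemma sum_antipode_mul_antipode_antipode {a : A} {ι : Type*} (r : Coalgebra.Repr k a ι) :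
    ∑ i ∈ r.index, antipode k (r.right i) * antipode k (antipode k (r.left i)) =
      algebraMap k A (Coalgebra.counit a) := by
  rw [← antipode_algebraMap, ← sum_antipode_mul_eq_algebraMap_counit r, map_sum]
  simp only [antipode_mul_antidistrib]

variable (k A) in
/-- The square of the antipode. -/
def antipodeSq : A →ₐ[k] A :=
  AlgHom.ofLinearMap (antipode k ∘ₗ antipode k) (by simp) fun x y => by
    simp [antipode_mul_antidistrib]

@[simp] lemma antipodeSq_apply (a : A) : antipodeSq k A a = antipode k (antipode k a) := rfl

variable (k A) in
/-- The algebra map `a ↦ ∑ a₁ ⊗ S a₂` to the enveloping algebra. -/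
def envRight : A →ₐ[k] A ⊗[k] Aᵐᵒᵖ :=
  (Algebra.TensorProduct.map (AlgHom.id k A) (antipodeAlgHomOp k A)).comp
    (Bialgebra.comulAlgHom k A)

variable (k A) in
/-- The algebra map `a ↦ ∑ S² a₂ ⊗ S a₁` to the enveloping algebra. -/
def envLeft : A →ₐ[k] A ⊗[k] Aᵐᵒᵖ :=
  ((Algebra.TensorProduct.map (antipodeSq k A) (antipodeAlgHomOp k A)).comp
    (Algebra.TensorProduct.comm k A A).toAlgHom).comp (Bialgebra.comulAlgHom k A)

lemma envRight_apply {a : A} {ι : Type*} (r : Coalgebra.Repr k a ι) :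
    envRight k A a = ∑ i ∈ r.index, r.left i ⊗ₜ op (antipode k (r.right i)) := by
  simp [envRight, ← r.eq]

lemma envLeft_apply {a : A} {ι : Type*} (r : Coalgebra.Repr k a ι) :
    envLeft k A a = ∑ i ∈ r.index,
      antipode k (antipode k (r.right i)) ⊗ₜ op (antipode k (r.left i)) := by
  simp [envLeft, ← r.eq]

/-- `a ↦ (y ↦ s a * y)`. -/
abbrev mulLeftOf (s : A →ₗ[k] A) : A →ₗ[k] A →ₗ[k] A := LinearMap.mul k A ∘ₗ s

/-- `a ↦ (y ↦ y * s a)`. -/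
abbrev mulRightOf (s : A →ₗ[k] A) : A →ₗ[k] A →ₗ[k] A := (LinearMap.mul k A).flip ∘ₗ s

lemma twistRight_mulLeftOf_bijective :
    Function.Bijective (twistRight (mulLeftOf (antipode k : A →ₗ[k] A))) := by
  refine twistRight_bijective (g := mulLeftOf LinearMap.id) (fun a y r => ?_) fun a y r => ?_
  · simp [← mul_assoc, ← Finset.sum_mul, sum_antipode_mul_eq_algebraMap_counit r,
      Algebra.smul_def]
  · simp [← mul_assoc, ← Finset.sum_mul, sum_mul_antipode_eq_algebraMap_counit r,
      Algebra.smul_def]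

/-- Right multiplication reverses the order of the factors, so the inverse of `S` is needed for the
opposite convolution. Applying `S` to the antipode axioms shows that `S²` serves. -/
lemma twistRight_mulRightOf_bijective :
    Function.Bijective (twistRight (mulRightOf (antipode k : A →ₗ[k] A))) := by
  refine twistRight_bijective (g := mulRightOf (antipode k ∘ₗ antipode k)) (fun a y r => ?_)
    fun a y r => ?_
  · simp [mul_assoc, ← Finset.mul_sum, sum_antipode_antipode_mul_antipode r,
      Algebra.smul_def, Algebra.commutes]
  · simp [mul_assoc, ← Finset.mul_sum, sum_antipode_mul_antipode_antipode r,
      Algebra.smul_def, Algebra.commutes]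

lemma twistLeft_mulRightOf_bijective :
    Function.Bijective (twistLeft (mulRightOf (antipode k : A →ₗ[k] A))) := by
  refine twistLeft_bijective (g := mulRightOf LinearMap.id) (fun a y r => ?_) fun a y r => ?_
  · simp [mul_assoc, ← Finset.mul_sum, sum_mul_antipode_eq_algebraMap_counit r,
      Algebra.smul_def, Algebra.commutes]
  · simp [mul_assoc, ← Finset.mul_sum, sum_antipode_mul_eq_algebraMap_counit r,
      Algebra.smul_def, Algebra.commutes]

lemma twistLeft_mulLeftOf_bijective :
    Function.Bijective (twistLeft (mulLeftOf (antipode k : A →ₗ[k] A))) := by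
  refine twistLeft_bijective (g := mulLeftOf (antipode k ∘ₗ antipode k)) (fun a y r => ?_)
    fun a y r => ?_
  · simp [← mul_assoc, ← Finset.sum_mul, sum_antipode_mul_antipode_antipode r,
      Algebra.smul_def]
  · simp [← mul_assoc, ← Finset.sum_mul, sum_antipode_antipode_mul_antipode r,
      Algebra.smul_def]

/-- The representation of the coproduct of `leftWindingHom π a` induced by one of `a`. -/
def leftWindingRepr (π : A →ₐ[k] k) {a : A} {ι : Type*} (r : Coalgebra.Repr k a ι) :
    Coalgebra.Repr k (leftWindingHom π a) ι where
  index := r.index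
  left i := leftWindingHom π (r.left i)
  right := r.right
  eq := by rw [comul_leftWindingHom, ← r.eq]; simp

/-- The representation of the coproduct of `rightWindingHom π a` induced by one of `a`. -/
def rightWindingRepr (π : A →ₐ[k] k) {a : A} {ι : Type*} (r : Coalgebra.Repr k a ι) :
    Coalgebra.Repr k (rightWindingHom π a) ι where
  index := r.index
  left := r.left
  right i := rightWindingHom π (r.right i)
  eq := by rw [comul_rightWindingHom, ← r.eq]; simp

lemma counit_leftWindingHom (π : A →ₐ[k] k) (a : A) :
    Coalgebra.counit (R := k) (leftWindingHom π a) = π a := by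
  have r := Coalgebra.Repr.arbitrary k a
  have h := congrArg (fun x => π (TensorProduct.rid k A x)) (Coalgebra.sum_tmul_counit_eq r)
  simp only [map_sum, TensorProduct.rid_tmul, one_smul, map_smul] at h
  rw [leftWindingHom_apply π r, map_sum, ← h]
  simp [mul_comm]

lemma counit_rightWindingHom (π : A →ₐ[k] k) (a : A) :
    Coalgebra.counit (R := k) (rightWindingHom π a) = π a := by
  have r := Coalgebra.Repr.arbitrary k a
  have h := congrArg π (Coalgebra.sum_counit_smul r)
  simp only [map_sum, map_smul] at h
  rw [rightWindingHom_apply π r, map_sum, ← h]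
  simp [mul_comm]

/-- The square of a bijective antipode, as an automorphism. -/
def antipodeSqEquiv (hS : Function.Bijective (antipode k : A → A)) : A ≃ₐ[k] A :=
  AlgEquiv.ofBijective (antipodeSq k A) (hS.comp hS)

@[simp] lemma antipodeSqEquiv_apply (hS : Function.Bijective (antipode k : A → A)) (a : A) :
    antipodeSqEquiv hS a = antipode k (antipode k a) := rfl

lemma opTensor_bijective : Function.Bijective
    ((opLinearEquiv k : A ≃ₗ[k] Aᵐᵒᵖ).toLinearMap.lTensor A) :=
  (LinearEquiv.lTensor A (opLinearEquiv k : A ≃ₗ[k] Aᵐᵒᵖ)).bijective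

/-- With `δ a = ∑ a₁ ⊗ S a₂` the twisted product is `∑ S a₂ * S² (ξ a₁)`. As `Δ ξ = (ξ ⊗ id) Δ`,
this is `S` applied to the antipode axiom at `ξ a`, giving `ε (ξ a) = π₀ a`. -/
theorem isNakayama_antipodeSq_mul_leftWinding [IsNoetherianRing A]
    (hS : Function.Bijective (antipode k : A → A)) {d : ℕ}
    (h : IsLeftASGorenstein (Bialgebra.counitAlgHom k A) d) :
    IsNakayama d (antipodeSqEquiv hS * leftWinding (integralCharacter h)) := by
  refine isNakayama_of_baseChange h (envRight k A) _
    (ΘR := (opLinearEquiv k).toLinearMap.lTensor A ∘ₗ twistRight (mulLeftOf (antipode k)))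
    (ΘL := (opLinearEquiv k).toLinearMap.lTensor A ∘ₗ twistRight (mulRightOf (antipode k)))
    (opTensor_bijective.comp twistRight_mulLeftOf_bijective) (fun a y => ?_)
    (opTensor_bijective.comp twistRight_mulRightOf_bijective) (fun a y => ?_) (fun a => ?_)
    fun a => ?_ <;> have r := Coalgebra.Repr.arbitrary k a
  · rw [envRight_apply r, LinearMap.comp_apply, twistRight_tmul _ r]
    simp [Finset.mul_sum]
  · rw [envRight_apply r, LinearMap.comp_apply, twistRight_tmul _ r]
    simp [Finset.sum_mul]
  · rw [envRight_apply r, map_sum]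
    simpa using sum_mul_antipode_eq_algebraMap_counit r
  · rw [envRight_apply r, map_sum, ← counit_leftWindingHom,
      ← sum_antipode_mul_antipode_antipode (leftWindingRepr (integralCharacter h) r)]
    rfl

/-- With `δ a = ∑ S² a₂ ⊗ S a₁` the factor `S⁻²` of `ν` cancels `S²`, leaving `∑ S a₁ * φ a₂`. As `Δ
φ = (id ⊗ φ) Δ`, this is the antipode axiom at `φ a`, giving `ε (φ a) = π₀ a`. -/
theorem isNakayama_rightWinding_mul_antipodeSq_inv [IsNoetherianRing A]
    (hS : Function.Bijective (antipode k : A → A)) {d : ℕ}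
    (h : IsLeftASGorenstein (Bialgebra.counitAlgHom k A) d) :
    IsNakayama d (rightWinding (integralCharacter h) * (antipodeSqEquiv hS)⁻¹) := by
  have hsq : Function.Bijective ((antipodeSqEquiv hS).toLinearMap.rTensor Aᵐᵒᵖ) :=
    (LinearEquiv.rTensor Aᵐᵒᵖ (antipodeSqEquiv hS).toLinearEquiv).bijective
  refine isNakayama_of_baseChange h (envLeft k A) _
    (ΘR := (antipodeSqEquiv hS).toLinearMap.rTensor Aᵐᵒᵖ ∘ₗ
      (opLinearEquiv k).toLinearMap.lTensor A ∘ₗ twistLeft (mulLeftOf (antipode k)))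
    (ΘL := (antipodeSqEquiv hS).toLinearMap.rTensor Aᵐᵒᵖ ∘ₗ
      (opLinearEquiv k).toLinearMap.lTensor A ∘ₗ twistLeft (mulRightOf (antipode k)))
    (hsq.comp (opTensor_bijective.comp twistLeft_mulLeftOf_bijective)) (fun a y => ?_)
    (hsq.comp (opTensor_bijective.comp twistLeft_mulRightOf_bijective)) (fun a y => ?_)
    (fun a => ?_) fun a => ?_ <;> have r := Coalgebra.Repr.arbitrary k a
  · rw [envLeft_apply r, LinearMap.comp_apply, LinearMap.comp_apply, twistLeft_tmul _ r]
    simp [Finset.mul_sum]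
  · rw [envLeft_apply r, LinearMap.comp_apply, LinearMap.comp_apply, twistLeft_tmul _ r]
    simp [Finset.sum_mul]
  · rw [envLeft_apply r, map_sum]
    simpa using sum_antipode_antipode_mul_antipode r
  · rw [envLeft_apply r, map_sum, ← counit_rightWindingHom,
      ← sum_antipode_mul_eq_algebraMap_counit (rightWindingRepr (integralCharacter h) r)]
    refine Finset.sum_congr rfl fun i _ => ?_
    rw [twistedMul_tmul]
    change antipode k (r.left i) * rightWinding _ ((antipodeSqEquiv hS).symm
      (antipodeSqEquiv hS (r.right i))) = _
    rw [AlgEquiv.symm_apply_apply]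
    rfl

end Hopf

/-! ### Inner automorphisms and uniqueness of the Nakayama automorphism. -/

section Inner

variable {k : Type v} [Field k] {A : Type u} [Ring A] [Algebra k A]

variable (k A) in
/-- The subgroup of inner automorphisms. -/
def innerSubgroup : Subgroup (A ≃ₐ[k] A) where
  carrier := {f | IsInner f}
  mul_mem' := by
    rintro f g ⟨w, hw⟩ ⟨z, hz⟩
    exact ⟨w * z, fun a => by simp [AlgEquiv.mul_apply, hw, hz, mul_assoc]⟩
  one_mem' := ⟨1, fun a => by simp⟩
  inv_mem' := by
    rintro f ⟨w, hw⟩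
    exact ⟨w⁻¹, fun a => f.injective (by
      rw [hw (_ * _), show f (f⁻¹ a) = a from f.apply_symm_apply a]
      simp [mul_assoc])⟩

lemma mem_innerSubgroup {f : A ≃ₐ[k] A} : f ∈ innerSubgroup k A ↔ IsInner f := Iff.rfl

instance innerSubgroup_normal : (innerSubgroup k A).Normal where
  conj_mem := by
    rintro f ⟨w, hw⟩ g
    refine ⟨Units.map (g : A →* A) w, fun a => ?_⟩
    rw [AlgEquiv.mul_apply, AlgEquiv.mul_apply, hw, map_mul, map_mul, ← AlgEquiv.mul_apply,
      mul_inv_cancel]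
    rfl

/-- The class of an automorphism modulo inner automorphisms. -/
abbrev outerClass (ν : A ≃ₐ[k] A) : (A ≃ₐ[k] A) ⧸ innerSubgroup k A := QuotientGroup.mk ν

lemma outerClass_pow_eq_one {ν : A ≃ₐ[k] A} {n : ℕ} :
    outerClass ν ^ n = 1 ↔ IsInner (ν ^ n : A ≃ₐ[k] A) :=
  QuotientGroup.eq_one_iff (ν ^ n)

/-- Nakayama automorphisms agree up to inner automorphisms. -/
lemma IsNakayama.outerClass_eq {d : ℕ} {ν ν' : A ≃ₐ[k] A} (h : IsNakayama d ν)
    (h' : IsNakayama d ν') : outerClass ν = outerClass ν' := by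
  obtain ⟨f, hf⟩ := h.exists_equiv
  obtain ⟨f', hf'⟩ := h'.exists_equiv
  let g := f.symm.trans f'
  have hg : ∀ y a x, g (y * a * ν x) = y * g a * ν' x := fun y a x => by
    obtain ⟨e, rfl⟩ := f.surjective a
    rw [← hf]
    simp only [g, AddEquiv.trans_apply, AddEquiv.symm_apply_apply]
    exact hf' e x y
  -- A left linear bijection of `A` is right multiplication by `g 1`, which is thus a unit; right
  -- linearity then says that it conjugates `ν` into `ν'`.
  have hleft : ∀ y, g y = y * g 1 := fun y => by simpa using hg y 1 1
  have hright : ∀ x, ν x * g 1 = g 1 * ν' x := fun x => by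
    rw [← hleft]
    simpa using hg 1 1 x
  obtain ⟨z, hz⟩ := g.surjective 1
  rw [hleft] at hz
  have hz' : g 1 * z = 1 := g.injective (by rw [hleft, mul_assoc, hz, mul_one])
  let w : Aˣ := ⟨z, g 1, hz, hz'⟩
  rw [eq_comm, QuotientGroup.eq_iff_div_mem, mem_innerSubgroup]
  refine ⟨w, fun a => ?_⟩
  obtain ⟨x, rfl⟩ := ν.surjective a
  rw [div_eq_mul_inv, AlgEquiv.mul_apply, ← AlgEquiv.mul_apply ν⁻¹, inv_mul_cancel,
    AlgEquiv.one_apply]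
  change ν' x = z * ν x * g 1
  rw [mul_assoc, hright, ← mul_assoc, hz, one_mul]

end Inner

/-! ### Orders with values in `ℕ∞`. -/

section Order

/-- `orderOf` encodes infinite order as `0`, hence the case distinction. -/
lemma iInf_pow_eq_one {G : Type*} [Group G] (x : G) :
    (⨅ (n : ℕ) (_ : 0 < n ∧ x ^ n = 1), (n : ℕ∞)) =
      if orderOf x = 0 then ⊤ else (orderOf x : ℕ∞) := by
  split_ifs with h
  · refine iInf₂_eq_top.2 fun n hn => ?_
    have := orderOf_dvd_of_pow_eq_one hn.2
    rw [h, zero_dvd_iff] at this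
    exact absurd this hn.1.ne'
  · refine le_antisymm (iInf₂_le _ ⟨Nat.pos_of_ne_zero h, pow_orderOf_eq_one x⟩)
      (le_iInf₂ fun n hn => ?_)
    exact_mod_cast Nat.le_of_dvd hn.1 (orderOf_dvd_of_pow_eq_one hn.2)

variable {k : Type v} [Field k] {A : Type u} [Ring A] [Algebra k A]

lemma outerOrder_eq (ν : A ≃ₐ[k] A) : outerOrder ν =
    if orderOf (outerClass ν) = 0 then ⊤ else (orderOf (outerClass ν) : ℕ∞) := by
  rw [← iInf_pow_eq_one]
  simp only [outerOrder, outerClass_pow_eq_one]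

end Order

/-! ### Winding automorphisms, the antipode and the counit. -/

section Winding

open HopfAlgebra WithConv

variable {k : Type v} [Field k] {A : Type u} [Ring A] [HopfAlgebra k A]

lemma leftWinding_characterInv (π : A →ₐ[k] k) :
    leftWinding (characterInv π) = (leftWinding π)⁻¹ := by
  ext; rfl

lemma rightWinding_characterInv (π : A →ₐ[k] k) :
    rightWinding (characterInv π) = (rightWinding π)⁻¹ := by
  ext; rfl

lemma commute_rightWinding_leftWinding (π ρ : A →ₐ[k] k) :
    Commute (rightWinding π) (leftWinding ρ) := by
  ext a
  have r := Coalgebra.Repr.arbitrary k a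
  change rightWindingHom π (leftWindingHom ρ a) = leftWindingHom ρ (rightWindingHom π a)
  rw [rightWindingHom_apply π (leftWindingRepr ρ r), rightWindingHom_apply π r, map_sum]
  simp [leftWindingRepr]

/-- A left and a right inverse of `g` in the convolution algebra coincide. -/
lemma eq_of_convInverse {f g h : A →ₗ[k] A}
    (hl : ∀ a (r : Coalgebra.Repr k a (A × A)), ∑ i ∈ r.index, f (r.left i) * g (r.right i) =
      algebraMap k A (Coalgebra.counit a))
    (hr : ∀ a (r : Coalgebra.Repr k a (A × A)), ∑ i ∈ r.index, g (r.left i) * h (r.right i) =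
      algebraMap k A (Coalgebra.counit a)) : f = h := by
  refine toConv_injective (left_inv_eq_right_inv (a := toConv g) ?_ ?_) <;> ext a
  · exact ((Coalgebra.Repr.arbitrary k a).convMul_apply _ _).trans (hl a _)
  · exact ((Coalgebra.Repr.arbitrary k a).convMul_apply _ _).trans (hr a _)

lemma sum_map_antipode_mul (f : A →ₐ[k] A) {a : A} (r : Coalgebra.Repr k a (A × A)) :
    ∑ i ∈ r.index, f (antipode k (r.left i)) * f (r.right i) =
      algebraMap k A (Coalgebra.counit a) := by
  simpa using congrArg f (sum_antipode_mul_eq_algebraMap_counit r)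

lemma sum_map_mul_antipode (f : A →ₐ[k] A) {a : A} (r : Coalgebra.Repr k a (A × A)) :
    ∑ i ∈ r.index, f (r.left i) * f (antipode k (r.right i)) =
      algebraMap k A (Coalgebra.counit a) := by
  simpa using congrArg f (sum_mul_antipode_eq_algebraMap_counit r)

/-- Both sides are convolution inverses of the left winding map: on the left because it is an
algebra map, on the right by the antipode axiom at the element wound by `π` on the left and by `π ∘
S` on the right. -/
lemma leftWinding_antipode (π : A →ₐ[k] k) (a : A) :
    leftWinding π (antipode k a) = antipode k ((rightWinding π)⁻¹ a) := by
  rw [← rightWinding_characterInv]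
  refine LinearMap.congr_fun (eq_of_convInverse
    (f := (leftWindingHom π).toLinearMap ∘ₗ antipode k) (g := (leftWindingHom π).toLinearMap)
    (h := antipode k ∘ₗ (rightWindingHom (characterInv π)).toLinearMap)
    (fun a r => sum_map_antipode_mul (leftWindingHom π) r) fun a r => ?_) a
  have h := sum_mul_antipode_eq_algebraMap_counit
    (leftWindingRepr π (rightWindingRepr (characterInv π) r))
  refine h.trans (congrArg _ ((counit_leftWindingHom _ _).trans ?_))
  rw [rightWindingHom_apply _ r, map_sum, ← map_sum_mul_antipode π r]
  simp [characterInv_apply, mul_comm]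

lemma rightWinding_antipode (π : A →ₐ[k] k) (a : A) :
    rightWinding π (antipode k a) = antipode k ((leftWinding π)⁻¹ a) := by
  rw [← leftWinding_characterInv]
  refine (LinearMap.congr_fun (eq_of_convInverse
    (f := antipode k ∘ₗ (leftWindingHom (characterInv π)).toLinearMap)
    (g := (rightWindingHom π).toLinearMap)
    (h := (rightWindingHom π).toLinearMap ∘ₗ antipode k) (fun a r => ?_)
    fun a r => sum_map_mul_antipode (rightWindingHom π) r) a).symm
  have h := sum_antipode_mul_eq_algebraMap_counit
    (rightWindingRepr π (leftWindingRepr (characterInv π) r))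
  refine h.trans (congrArg _ ((counit_rightWindingHom _ _).trans ?_))
  rw [leftWindingHom_apply _ r, map_sum, ← map_sum_antipode_mul π r]
  simp [characterInv_apply]

variable (hS : Function.Bijective (antipode k : A → A))

lemma commute_antipodeSq_leftWinding (π : A →ₐ[k] k) :
    Commute (antipodeSqEquiv hS) (leftWinding π) := by
  refine Commute.symm (AlgEquiv.ext fun a => ?_)
  change leftWinding π (antipode k (antipode k a)) = antipode k (antipode k (leftWinding π a))
  rw [leftWinding_antipode, ← rightWinding_characterInv, rightWinding_antipode,
    leftWinding_characterInv, inv_inv]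

lemma commute_antipodeSq_rightWinding (π : A →ₐ[k] k) :
    Commute (antipodeSqEquiv hS) (rightWinding π) := by
  refine Commute.symm (AlgEquiv.ext fun a => ?_)
  change rightWinding π (antipode k (antipode k a)) = antipode k (antipode k (rightWinding π a))
  rw [rightWinding_antipode, ← leftWinding_characterInv, leftWinding_antipode,
    rightWinding_characterInv, inv_inv]

lemma counit_antipodeSqEquiv_pow (n : ℕ) (a : A) :
    Coalgebra.counit (R := k) ((antipodeSqEquiv hS ^ n) a) = Coalgebra.counit (R := k) a := by
  induction n generalizing a with
  | zero => simp
  | succ n ih => rw [pow_succ, AlgEquiv.mul_apply, ih]; simp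

lemma antipode_iterate_eq (n : ℕ) (a : A) :
    (antipode k : A → A)^[2 * n] a = (antipodeSqEquiv hS ^ n) a := by
  induction n with
  | zero => simp
  | succ n ih =>
    rw [pow_succ', AlgEquiv.mul_apply, ← ih, antipodeSqEquiv_apply, mul_add, add_comm,
      Function.iterate_add_apply]
    rfl

lemma rightWinding_pow_antipode (π : A →ₐ[k] k) (n : ℕ) (a : A) :
    (rightWinding π ^ n) (antipode k a) = antipode k (((leftWinding π)⁻¹ ^ n) a) := by
  induction n generalizing a with
  | zero => simp
  | succ n ih => rw [pow_succ, AlgEquiv.mul_apply, rightWinding_antipode, ih, pow_succ,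
      AlgEquiv.mul_apply]

include hS in
lemma rightWinding_pow_eq_one (π : A →ₐ[k] k) {n : ℕ} (h : leftWinding π ^ n = 1) :
    rightWinding π ^ n = 1 := by
  ext a
  obtain ⟨a, rfl⟩ := hS.2 a
  rw [rightWinding_pow_antipode, inv_pow, h, inv_one]
  rfl

/-- A power of a left winding is the left winding of its composite with the counit, since it touches
only the left leg of the coproduct. -/
lemma leftWinding_pow_apply (π : A →ₐ[k] k) (n : ℕ) {a : A} {ι : Type*}
    (r : Coalgebra.Repr k a ι) : (leftWinding π ^ n) a =
      ∑ i ∈ r.index, Coalgebra.counit (R := k) ((leftWinding π ^ n) (r.left i)) • r.right i := by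
  suffices h : ∃ s : Coalgebra.Repr k ((leftWinding π ^ n) a) ι, s.index = r.index ∧
      (∀ i, s.left i = (leftWinding π ^ n) (r.left i)) ∧ s.right = r.right by
    obtain ⟨s, h1, h2, h3⟩ := h
    have := Coalgebra.sum_counit_smul s
    simp only [h1, h2, h3] at this
    exact this.symm
  induction n with
  | zero => exact ⟨r, rfl, fun i => rfl, rfl⟩
  | succ n ih =>
    obtain ⟨s, h1, h2, h3⟩ := ih
    rw [pow_succ']
    exact ⟨leftWindingRepr π s, h1, fun i => congrArg (leftWindingHom π) (h2 i), h3⟩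

lemma leftWinding_pow_ext (π : A →ₐ[k] k) {m n : ℕ}
    (h : ∀ a, Coalgebra.counit (R := k) ((leftWinding π ^ m) a) =
      Coalgebra.counit (R := k) ((leftWinding π ^ n) a)) :
    leftWinding π ^ m = leftWinding π ^ n := by
  ext a
  have r := Coalgebra.Repr.arbitrary k a
  rw [leftWinding_pow_apply π m r, leftWinding_pow_apply π n r]
  simp only [h]

/-- The counit is multiplicative with commutative target, hence blind to conjugation. -/
lemma counit_of_isInner {f : A ≃ₐ[k] A} (hf : IsInner f) (a : A) :
    Coalgebra.counit (R := k) (f a) = Coalgebra.counit (R := k) a := by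
  obtain ⟨w, hw⟩ := hf
  rw [hw, Bialgebra.counit_mul, Bialgebra.counit_mul, mul_right_comm, ← Bialgebra.counit_mul,
    Units.mul_inv, Bialgebra.counit_one, one_mul]

end Winding

/-! ### Characters and one-dimensional modules. -/

section Characters

variable {k : Type v} [Field k] {A : Type u} [Ring A] [Algebra k A]

lemma finrank_quotient_ker (χ : A →ₐ[k] k) :
    Module.finrank k (A ⧸ (RingHom.ker χ : Submodule A A)) = 1 := by
  refine finrank_eq_one_iff'.2 ⟨Submodule.Quotient.mk 1, fun h => ?_, fun x => ?_⟩
  · have := (RingHom.mem_ker (f := χ)).1 ((Submodule.Quotient.mk_eq_zero _).1 h)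
    simp at this
  · obtain ⟨x, rfl⟩ := Submodule.Quotient.mk_surjective _ x
    refine ⟨χ x, (Submodule.Quotient.eq _).2 ((RingHom.mem_ker (f := χ)).2 ?_)⟩
    change χ (χ x • 1 - x) = 0
    simp

/-- The kernel of `χ` annihilates the first quotient, hence the second, so it lies in the kernel of
`ψ`; applied to `a - χ a` this gives equality. -/
lemma eq_of_quotient_ker_equiv {χ ψ : A →ₐ[k] k}
    (e : (A ⧸ (RingHom.ker χ : Submodule A A)) ≃ₗ[A] (A ⧸ (RingHom.ker ψ : Submodule A A))) :
    χ = ψ := by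
  have key : ∀ a, χ a = 0 → ψ a = 0 := fun a ha => by
    obtain ⟨y, hy⟩ := Submodule.Quotient.mk_surjective _ (e.symm (Submodule.Quotient.mk 1))
    have h1 : ∀ x : A ⧸ (RingHom.ker χ : Submodule A A), a • x = 0 := fun x => by
      obtain ⟨x, rfl⟩ := Submodule.Quotient.mk_surjective _ x
      refine (Submodule.Quotient.mk_eq_zero _).2 ((RingHom.mem_ker (f := χ)).2 ?_)
      simp [ha]
    have h2 := congrArg e (h1 (e.symm (Submodule.Quotient.mk 1)))
    rw [map_smul, e.apply_symm_apply, map_zero] at h2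
    have h3 := (RingHom.mem_ker (f := ψ)).1 ((Submodule.Quotient.mk_eq_zero _).1 h2)
    simpa using h3
  ext a
  have := key (a - algebraMap k A (χ a)) (by simp)
  rw [map_sub, AlgHom.commutes, sub_eq_zero] at this
  exact this.symm

/-- An algebra with finitely many one-dimensional modules has finitely many characters. -/
lemma FinitelyManyOneDimModules.finite_characters (h : FinitelyManyOneDimModules k A) :
    Finite (A →ₐ[k] k) := by
  obtain ⟨n, L, hL⟩ := h
  choose i hi using fun χ : A →ₐ[k] k =>
    hL (A ⧸ (RingHom.ker χ : Submodule A A)) (finrank_quotient_ker χ)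
  refine Finite.of_injective i fun χ ψ hχψ => ?_
  obtain ⟨e⟩ := hi χ
  obtain ⟨e'⟩ := hi ψ
  rw [← hχψ] at e'
  exact eq_of_quotient_ker_equiv (e.trans e'.symm)

end Characters

end

end HopfNakayama

/-! ### The antipode formula and the comparison of orders. -/

open HopfNakayama in
theorem proposition4p6 {k : Type v} [Field k] {A : Type u} [Ring A] [HopfAlgebra k A]
    [IsNoetherianRing A] [IsNoetherianRing Aᵐᵒᵖ]
    (hS : Function.Bijective (HopfAlgebra.antipode k : A → A))
    (d : ℕ) (hA : HopfNakayama.IsASGorenstein (Bialgebra.counitAlgHom k A) d) :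
    -- the antipode formula, and the commutation of its three factors
    (∃ γ : A ≃ₐ[k] A, HopfNakayama.IsInner γ ∧
      (∀ a : A, (HopfAlgebra.antipode k : A → A)^[4] a =
        (γ * HopfNakayama.phi hA * (HopfNakayama.xi hA)⁻¹) a) ∧
      Commute γ (HopfNakayama.phi hA) ∧ Commute γ (HopfNakayama.xi hA) ∧
      Commute (HopfNakayama.phi hA) (HopfNakayama.xi hA)) ∧
    -- a Nakayama automorphism exists, and the Nakayama order is once or twice the integral order
    (∃ ν : A ≃ₐ[k] A, HopfNakayama.IsNakayama d ν) ∧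
    ((∀ ν : A ≃ₐ[k] A, HopfNakayama.IsNakayama d ν →
        HopfNakayama.outerOrder ν = HopfNakayama.integralOrder hA) ∨
      (∀ ν : A ≃ₐ[k] A, HopfNakayama.IsNakayama d ν →
        HopfNakayama.outerOrder ν = 2 * HopfNakayama.integralOrder hA)) ∧
    -- if the integral order `n` is finite, then `S ^ (4 * n)` is inner
    (∀ n : ℕ, HopfNakayama.integralOrder hA = n →
      HopfNakayama.IsInner (HopfAlgebra.antipode k : A → A)^[4 * n]) ∧
    -- the case of finitely many one-dimensional modules
    (HopfNakayama.FinitelyManyOneDimModules k A →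
      HopfNakayama.integralOrder hA ≠ ⊤ ∧
      (∃ m : ℕ, 0 < m ∧ HopfNakayama.IsInner (HopfAlgebra.antipode k : A → A)^[m]) ∧
      (∀ ν : A ≃ₐ[k] A, HopfNakayama.IsNakayama d ν →
        ∃ m : ℕ, 0 < m ∧ HopfNakayama.IsInner (ν ^ m : A ≃ₐ[k] A))) := by
  let ξ := xi hA
  let φ := phi hA
  let s := antipodeSqEquiv hS
  have hsξ : Commute s ξ := commute_antipodeSq_leftWinding hS _
  have hsφ : Commute s φ := commute_antipodeSq_rightWinding hS _
  have hφξ : Commute φ ξ := commute_rightWinding_leftWinding _ _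
  have hN : IsNakayama d (s * ξ) := isNakayama_antipodeSq_mul_leftWinding hS hA.left
  have hN' : IsNakayama d (φ * s⁻¹) := isNakayama_rightWinding_mul_antipodeSq_inv hS hA.left
  -- This is the quotient `(s * ξ) / (φ * s⁻¹)` of the two Nakayama automorphisms, rearranged using
  -- that `s` commutes with `ξ`.
  let γ := s ^ 2 * ξ * φ⁻¹
  have hγ : γ ∈ innerSubgroup k A := by
    have h := hN.outerClass_eq hN'
    rw [QuotientGroup.eq_iff_div_mem] at h
    convert h using 1
    rw [div_eq_mul_inv, mul_inv_rev, inv_inv]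
    rw [← mul_assoc, mul_assoc s ξ s, ← hsξ.eq, ← mul_assoc, ← sq]
  have hγφ : Commute γ φ :=
    ((hsφ.pow_left 2).mul_left hφξ.symm).mul_left (Commute.refl φ).inv_left
  have hγξ : Commute γ ξ :=
    ((hsξ.pow_left 2).mul_left (Commute.refl ξ)).mul_left hφξ.inv_left
  have hs2 : s ^ 2 = γ * φ * ξ⁻¹ := by simp [γ]
  have hpow : ∀ n, ξ ^ n = 1 → s ^ (2 * n) ∈ innerSubgroup k A := fun n hn => by
    have hn' : φ ^ n = 1 := rightWinding_pow_eq_one hS _ hn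
    have h1 : s ^ (2 * n) = γ ^ n := by
      rw [pow_mul, hs2, (hγξ.mul_left hφξ).inv_right.mul_pow, hγφ.mul_pow, hn', inv_pow, hn]
      simp
    rw [h1]
    exact Subgroup.pow_mem _ hγ n
  have hSpow : ∀ n, ξ ^ n = 1 → IsInner (HopfAlgebra.antipode k : A → A)^[4 * n] := fun n hn => by
    obtain ⟨w, hw⟩ := hpow n hn
    refine ⟨w, fun a => ?_⟩
    rw [← hw, show 4 * n = 2 * (2 * n) by ring, antipode_iterate_eq hS]
  have hio : integralOrder hA = if orderOf ξ = 0 then ⊤ else (orderOf ξ : ℕ∞) :=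
    iInf_pow_eq_one ξ
  have hdvd : orderOf (outerClass (s * ξ)) ∣ 2 * orderOf ξ := by
    refine orderOf_dvd_of_pow_eq_one (outerClass_pow_eq_one.2 ?_)
    have hn := pow_orderOf_eq_one ξ
    rw [hsξ.mul_pow, mul_comm 2, pow_mul ξ, hn, one_pow, mul_one, mul_comm]
    exact hpow _ hn
  -- If `(s * ξ) ^ m = s ^ m * ξ ^ m` is inner it preserves the counit; so does `s ^ m`, hence also
  -- `ξ ^ m`, which must then be the identity.
  have hdvd' : orderOf ξ ∣ orderOf (outerClass (s * ξ)) := by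
    refine orderOf_dvd_of_pow_eq_one ?_
    have h := outerClass_pow_eq_one.1 (pow_orderOf_eq_one (outerClass (s * ξ)))
    generalize orderOf (outerClass (s * ξ)) = m at h ⊢
    rw [← pow_zero ξ]
    refine leftWinding_pow_ext _ fun a => ?_
    have h1 := counit_of_isInner h a
    rw [hsξ.mul_pow, AlgEquiv.mul_apply, counit_antipodeSqEquiv_pow] at h1
    rw [pow_zero]
    exact h1
  refine ⟨⟨γ, hγ, fun a => ?_, hγφ, hγξ, hφξ⟩, ⟨_, hN⟩, ?_, fun n hn => hSpow n ?_, fun hfin => ?_⟩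
  · rw [← hs2, ← antipode_iterate_eq hS]
  · have hout : ∀ ν : A ≃ₐ[k] A, IsNakayama d ν → outerOrder ν =
        if orderOf (outerClass (s * ξ)) = 0 then ⊤ else (orderOf (outerClass (s * ξ)) : ℕ∞) :=
      fun ν hν => by rw [outerOrder_eq, hν.outerClass_eq hN]
    generalize orderOf (outerClass (s * ξ)) = m at hout hdvd hdvd'
    rw [hio]
    generalize orderOf ξ = n at hdvd hdvd'
    -- For `n = 0`, that is infinite integral order, divisibility forces `m = 0`, and both orders
    -- are `⊤`. Otherwise `m = n * q` with `q ∣ 2`.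
    rcases Nat.eq_zero_or_pos n with rfl | hn
    · rw [zero_dvd_iff] at hdvd'
      subst hdvd'
      exact Or.inl fun ν hν => by rw [hout ν hν]
    · obtain ⟨q, rfl⟩ := hdvd'
      rw [mul_comm 2] at hdvd
      rcases (Nat.dvd_prime Nat.prime_two).1 (Nat.dvd_of_mul_dvd_mul_left hn hdvd) with rfl | rfl
      · exact Or.inl fun ν hν => by rw [hout ν hν, mul_one]
      · refine Or.inr fun ν hν => ?_
        rw [hout ν hν, if_neg (by omega), if_neg hn.ne']
        push_cast
        rw [mul_comm]
  · rw [hio] at hn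
    split_ifs at hn
    · exact absurd hn (by simp)
    · rw [← Nat.cast_injective hn]
      exact pow_orderOf_eq_one ξ
  · have hfinite := hfin.finite_characters
    obtain ⟨n, hn0, hn⟩ : ∃ n, 0 < n ∧ ξ ^ n = 1 := by
      -- The composites of the counit with the powers of `ξ` are characters, so two of them agree,
      -- and then so do the two powers.
      obtain ⟨m, n, hmn, h⟩ := Finite.exists_ne_map_eq_of_infinite fun m : ℕ =>
        (Bialgebra.counitAlgHom k A).comp ((ξ ^ m : A ≃ₐ[k] A) : A →ₐ[k] A)
      have : IsOfFinOrder ξ := by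
        rw [← not_not (a := IsOfFinOrder ξ), ← injective_pow_iff_not_isOfFinOrder]
        exact fun hinj => hmn (hinj (leftWinding_pow_ext _ fun a => DFunLike.congr_fun h a))
      exact ⟨orderOf ξ, this.orderOf_pos, pow_orderOf_eq_one ξ⟩
    have hord : orderOf ξ ≠ 0 := orderOf_ne_zero_iff.2 (isOfFinOrder_iff_pow_eq_one.2 ⟨n, hn0, hn⟩)
    refine ⟨by simp [hio, hord], ⟨4 * n, by omega, hSpow n hn⟩, fun ν hν => ⟨2 * orderOf ξ,
      by omega, ?_⟩⟩
    rw [← outerClass_pow_eq_one, hν.outerClass_eq hN]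
    exact orderOf_dvd_iff_pow_eq_one.1 hdvd
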